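/- Let $k$ be a commutative ring and let $\mathcal{A}=(A=\bigoplus_{i\in\mathbb{Z}}A^i,d)$ be a differential graded $k$-algebra (with $d$ of degree $+1$) such that $A^i=0$ for $i<0$, the ring $A^0$ is semisimple, and $d(A^0)=0$. Let $(L_x)_{x\in W}$ be a system of representatives of the isomorphism classes of simple right $A^0$-modules. Regard each $L_x$ as concentrated in degree $0$ with zero differential, and let $\hat L_x=L_x\otimes_{A^0}\mathcal{A}$, a dg right $\mathcal{A}$-module with differential $l\otimes a\mapsto l\otimes da$. Let $\mathrm{dgMod}(\mathcal{A})$ be the category of dg right $\mathcal{A}$-modules and $\mathrm{dgHot}(\mathcal{A})$ its homotopy category, which is triangulated with the shift $\{1\}$, where $(\{n\}M)^i=M^{i+n}$ and $d_{\{n\}M}=(-1)^n d_M$, and with the triangles isomorphic to standard mapping cone triangles as distinguished triangles. Consider two full subcategories of $\mathrm{dgHot}(\mathcal{A})$: - $\mathrm{dgPrae}$ is the smallest strict (i.e. closed under isomorphisms) full triangulated subcategory of $\mathrm{dgHot}(\mathcal{A})$ that contains all $\hat L_x$, $x\in W$. - $\mathrm{dgFilt}$ has as objects the dg modules $M$ that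 admit a finite filtration $0=F_0\subset F_1\subset\dots\subset F_n=M$ by dg submodules such that $F_i/F_{i-1}\cong\{l_i\}\hat L_{x_i}$ in $\mathrm{dgMod}(\mathcal{A})$ for $1\le i\le n$, for some $x_1,\dots,x_n\in W$ and integers $l_1\ge l_2\ge\dots\ge l_n$ (with $n\ge 0$). Then every object of $\mathrm{dgPrae}$ is isomorphic in $\mathrm{dgHot}(\mathcal{A})$ (i.e. homotopy equivalent) to an object of $\mathrm{dgFilt}$. Moreover $\mathrm{dgFilt}\subset\mathrm{dgPrae}$, and this inclusion is an equivalence of categories. -/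

import Mathlib

open CategoryTheory

universe u v

section InternalGrading

variable {M : Type v} [AddCommGroup M]

/-- The projection of an internally `ℤ`-graded abelian group onto its component of degree `i`. -/
noncomputable def gradedProj {gr : ℤ → AddSubgroup M} (h : DirectSum.IsInternal gr) (i : ℤ) :
    M →+ M :=
  (gr i).subtype.comp
    ((DFinsupp.evalAddMonoidHom i).comp
      (AddEquiv.ofBijective (DirectSum.coeAddMonoidHom gr) h).symm.toAddMonoidHom)

theorem gradedProj_mem {gr : ℤ → AddSubgroup M} (h : DirectSum.IsInternal gr) (i : ℤ) (x : M) :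
    gradedProj h i x ∈ gr i :=
  SetLike.coe_mem _

theorem gradedProj_coe {gr : ℤ → AddSubgroup M} (h : DirectSum.IsInternal gr) (i : ℤ)
    (v : DirectSum ℤ fun i => gr i) :
    gradedProj h i (DirectSum.coeAddMonoidHom gr v) = v i := by
  have : (AddEquiv.ofBijective (DirectSum.coeAddMonoidHom gr) h).symm
      (DirectSum.coeAddMonoidHom gr v) = v :=
    (AddEquiv.ofBijective (DirectSum.coeAddMonoidHom gr) h).symm_apply_apply v
  change (((AddEquiv.ofBijective (DirectSum.coeAddMonoidHom gr) h).symm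
      (DirectSum.coeAddMonoidHom gr v)) i : M) = v i
  rw [this]

theorem gradedProj_of_mem {gr : ℤ → AddSubgroup M} (h : DirectSum.IsInternal gr) {i : ℤ} {x : M}
    (hx : x ∈ gr i) : gradedProj h i x = x := by
  have := gradedProj_coe h i (DirectSum.of (fun i => gr i) i ⟨x, hx⟩)
  rw [DirectSum.coeAddMonoidHom_of, DirectSum.of_eq_same] at this
  exact this

theorem gradedProj_of_mem_ne {gr : ℤ → AddSubgroup M} (h : DirectSum.IsInternal gr) {i j : ℤ}
    (hij : i ≠ j) {x : M} (hx : x ∈ gr j) : gradedProj h i x = 0 := by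
  have := gradedProj_coe h i (DirectSum.of (fun i => gr i) j ⟨x, hx⟩)
  rw [DirectSum.coeAddMonoidHom_of, DirectSum.of_eq_of_ne _ _ _ hij] at this
  exact this

theorem mem_iSup_of_isInternal {gr : ℤ → AddSubgroup M} (h : DirectSum.IsInternal gr) (x : M) :
    x ∈ ⨆ i, gr i := by
  obtain ⟨v, rfl⟩ := h.2 x
  induction v using DirectSum.induction_on with
  | zero => simp
  | of i x =>
    rw [DirectSum.coeAddMonoidHom_of]
    exact AddSubgroup.mem_iSup_of_mem i x.2
  | add a b ha hb => rw [map_add]; exact add_mem ha hb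

/-- A family of subgroups that generates the group and admits projections is a grading. -/
theorem isInternal_of_proj {gr : ℤ → AddSubgroup M} (p : ℤ → M →+ M)
    (hp : ∀ i, ∀ x ∈ gr i, p i x = x) (hp' : ∀ i j, i ≠ j → ∀ x ∈ gr j, p i x = 0)
    (htop : ∀ x, x ∈ ⨆ i, gr i) : DirectSum.IsInternal gr := by
  have key : ∀ (v : DirectSum ℤ fun i => gr i) (i : ℤ),
      p i (DirectSum.coeAddMonoidHom gr v) = v i := by
    intro v i
    induction v using DirectSum.induction_on with
    | zero => simp
    | of j x =>
      rw [DirectSum.coeAddMonoidHom_of]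
      by_cases hij : i = j
      · subst hij
        rw [DirectSum.of_eq_same, hp _ _ x.2]
      · rw [DirectSum.of_eq_of_ne _ _ _ hij, hp' _ _ hij _ x.2]
        rfl
    | add a b ha hb =>
      rw [map_add, map_add, ha, hb]
      rfl
  constructor
  · rw [injective_iff_map_eq_zero]
    intro v hv
    refine DFinsupp.ext fun i => Subtype.ext ?_
    rw [← key v i, hv, map_zero]
    rfl
  · intro x
    have hle : ⨆ i, gr i ≤ (DirectSum.coeAddMonoidHom gr).range := iSup_le fun i x hx =>
      ⟨DirectSum.of (fun i => gr i) i ⟨x, hx⟩, DirectSum.coeAddMonoidHom_of _ _ _⟩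
    exact hle (htop x)

end InternalGrading

/-- The additive endomorphism of `M / N` induced by an additive endomorphism of `M` that
preserves `N`. -/
def quotientEnd {R M : Type*} [Ring R] [AddCommGroup M] [Module R M] (N : Submodule R M)
    (φ : M →+ M) (h : ∀ x ∈ N, φ x ∈ N) : M ⧸ N →+ M ⧸ N :=
  QuotientAddGroup.map N.toAddSubgroup N.toAddSubgroup φ (by exact h)

theorem quotientEnd_mkQ {R M : Type*} [Ring R] [AddCommGroup M] [Module R M]
    (N : Submodule R M) (φ : M →+ M) (h : ∀ x ∈ N, φ x ∈ N) (x : M) :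
    quotientEnd N φ h (N.mkQ x) = N.mkQ (φ x) :=
  rfl

/-- A differential graded `k`-algebra structure (cohomological grading by `ℤ`) on the `k`-algebra
`A`. -/
structure DGAlgebra (k : Type u) [CommRing k] (A : Type v) [Ring A] [Algebra k A] where
  /-- the homogeneous components `A^i` -/
  gr : ℤ → Submodule k A
  gradedMonoid : SetLike.GradedMonoid gr
  isInternal : DirectSum.IsInternal gr
  /-- the differential -/
  d : A →ₗ[k] A
  d_mem : ∀ (i : ℤ), ∀ a ∈ gr i, d a ∈ gr (i + 1)
  d_d : ∀ a, d (d a) = 0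
  leibniz : ∀ (i : ℤ), ∀ a ∈ gr i, ∀ b,
    d (a * b) = d a * b + ((i.negOnePow : ℤˣ) : ℤ) • (a * d b)

section

variable {k : Type u} [CommRing k] {A : Type v} [Ring A] [Algebra k A]

instance (𝒜 : DGAlgebra k A) : SetLike.GradedMonoid 𝒜.gr := 𝒜.gradedMonoid

/-- The ring `A^0`. -/
abbrev DGAlgebra.degZero (𝒜 : DGAlgebra k A) : Type v := 𝒜.gr 0

/-- The conditions: `A` is positively graded, `A^0` is semisimple, and `d(A^0) = 0`. -/
structure DGAlgebra.IsPositiveSemisimple (𝒜 : DGAlgebra k A) : Prop where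
  gr_neg : ∀ i : ℤ, i < 0 → 𝒜.gr i = ⊥
  semisimple : IsSemisimpleRing 𝒜.degZero
  d_degZero : ∀ a ∈ 𝒜.gr 0, 𝒜.d a = 0

/-- A dg right module over the dg algebra `𝒜`; right `A`-modules are modules over `Aᵐᵒᵖ`, so that
`m a` is `MulOpposite.op a • m`. (The `k`-module structure is the one coming from `k → A`, whose
image lies in `A^0` and is killed by `d`; hence components are `k`-submodules and the differential
is `k`-linear.) -/
structure DGModule (𝒜 : DGAlgebra k A) where
  /-- the underlying abelian group -/
  carrier : Type v
  [addCommGroup : AddCommGroup carrier]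
  [module : Module Aᵐᵒᵖ carrier]
  /-- the homogeneous components `M^i` -/
  gr : ℤ → AddSubgroup carrier
  isInternal : DirectSum.IsInternal gr
  smul_mem : ∀ (i j : ℤ), ∀ m ∈ gr i, ∀ a ∈ 𝒜.gr j, MulOpposite.op a • m ∈ gr (i + j)
  /-- the differential -/
  d : carrier →+ carrier
  d_mem : ∀ (i : ℤ), ∀ m ∈ gr i, d m ∈ gr (i + 1)
  d_d : ∀ m, d (d m) = 0
  leibniz : ∀ (i : ℤ), ∀ m ∈ gr i, ∀ a : A,
    d (MulOpposite.op a • m) =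
      MulOpposite.op a • d m + ((i.negOnePow : ℤˣ) : ℤ) • (MulOpposite.op (𝒜.d a) • m)

namespace DGModule

attribute [instance] DGModule.addCommGroup DGModule.module

variable {𝒜 : DGAlgebra k A}

instance : CoeSort (DGModule 𝒜) (Type v) := ⟨DGModule.carrier⟩

/-- The projection `M → M^i`, as an endomorphism of `M`. -/
noncomputable def proj (M : DGModule 𝒜) (i : ℤ) : M →+ M := gradedProj M.isInternal i

/-- Morphisms of dg modules: `A`-linear maps of degree zero commuting with the differentials. -/
@[ext]
structure Hom (M N : DGModule 𝒜) where
  /-- the underlying linear map -/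
  toLin : M →ₗ[Aᵐᵒᵖ] N
  map_gr : ∀ (i : ℤ), ∀ m ∈ M.gr i, toLin m ∈ N.gr i
  map_d : ∀ m, toLin (M.d m) = N.d (toLin m)

/-- The category `dgMod(𝒜)` of dg modules. -/
instance : Category (DGModule 𝒜) where
  Hom M N := Hom M N
  id M := ⟨LinearMap.id, fun _ _ h => h, fun _ => rfl⟩
  comp f g := ⟨g.toLin.comp f.toLin, fun i m h => g.map_gr i _ (f.map_gr i m h), fun m => by
    simp [f.map_d, g.map_d]⟩

/-- The underlying linear map of a morphism in `dgMod(𝒜)`. -/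
def lin {M N : DGModule 𝒜} (f : M ⟶ N) : M →ₗ[Aᵐᵒᵖ] N := Hom.toLin f

@[ext]
theorem hom_ext {M N : DGModule 𝒜} {f g : M ⟶ N} (h : lin f = lin g) : f = g := Hom.ext h

/-- Two morphisms `f`, `g` are homotopic if `f - g = d h + h d` for some `A`-linear map `h` of
degree `-1`. -/
def Homotopic : HomRel (DGModule 𝒜) := fun M N f g =>
  ∃ h : M →ₗ[Aᵐᵒᵖ] N, (∀ (i : ℤ), ∀ m ∈ M.gr i, h m ∈ N.gr (i - 1)) ∧
    ∀ m, lin f m - lin g m = N.d (h m) + h (M.d m)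

instance : Congruence (Homotopic (𝒜 := 𝒜)) where
  equivalence := by
    intro X Y
    refine ⟨fun f => ⟨0, fun _ _ _ => zero_mem _, fun m => by simp⟩, ?_, ?_⟩
    · rintro f g ⟨h, hd, hh⟩
      refine ⟨-h, fun i m hm => neg_mem (hd i m hm), fun m => ?_⟩
      rw [← neg_sub, hh]
      simp only [LinearMap.neg_apply, map_neg]
      abel
    · rintro f g e ⟨h, hd, hh⟩ ⟨h', hd', hh'⟩
      refine ⟨h + h', fun i m hm => add_mem (hd i m hm) (hd' i m hm), fun m => ?_⟩
      rw [← sub_add_sub_cancel _ (lin g m), hh, hh']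
      simp only [LinearMap.add_apply, map_add]
      abel
  comp_left := by
    rintro X Y Z f g g' ⟨h, hd, hh⟩
    refine ⟨h.comp (lin f), fun i m hm => hd i _ (f.map_gr i m hm), fun m => ?_⟩
    have h1 : lin f (X.d m) = Y.d (lin f m) := f.map_d m
    simp only [LinearMap.comp_apply, h1]
    exact hh _
  comp_right := by
    rintro X Y Z f f' g ⟨h, hd, hh⟩
    refine ⟨(lin g).comp h, fun i m hm => g.map_gr _ _ (hd i m hm), fun m => ?_⟩
    have h1 : ∀ y, lin g (Y.d y) = Z.d (lin g y) := g.map_d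
    have h2 : lin (f ≫ g) m - lin (f' ≫ g) m = lin g (lin f m - lin f' m) :=
      (map_sub (lin g) _ _).symm
    rw [h2, hh, map_add, h1]
    rfl

/-- The shift `{n}M`, with `({n}M)^i = M^(i+n)` and differential `(-1)^n d`. -/
def shift (n : ℤ) (M : DGModule 𝒜) : DGModule 𝒜 where
  carrier := M
  gr i := M.gr (i + n)
  isInternal := by
    refine isInternal_of_proj (fun i => M.proj (i + n))
      (fun i x hx => gradedProj_of_mem _ hx)
      (fun i j hij x hx => gradedProj_of_mem_ne _ (by omega) hx) (fun x => ?_)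
    refine (iSup_le fun i => ?_ : ⨆ i, M.gr i ≤ ⨆ i, M.gr (i + n))
      (mem_iSup_of_isInternal M.isInternal x)
    exact le_iSup_of_le (i - n) (le_of_eq (by rw [sub_add_cancel]))
  smul_mem i j m hm a ha := by
    have := M.smul_mem (i + n) j m hm a ha
    rwa [add_right_comm] at this
  d := ((n.negOnePow : ℤˣ) : ℤ) • M.d
  d_mem i m hm := by
    have := M.d_mem (i + n) m hm
    rw [add_right_comm] at this
    exact zsmul_mem this _
  d_d m := by simp [M.d_d]
  leibniz i m hm a := by
    have := M.leibniz (i + n) m hm a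
    simp only [AddMonoidHom.smul_apply, this, smul_add, Int.negOnePow_add, Units.val_mul]
    congr 1
    · exact smul_comm _ _ _
    · rw [smul_smul, mul_left_comm, ← Units.val_mul n.negOnePow, ← Int.negOnePow_add,
        Int.negOnePow_even _ (Even.add_self n), Units.val_one, mul_one]

/-- The shift functor `{n}` on `dgMod(𝒜)`. -/
def shiftFunctor (n : ℤ) : DGModule 𝒜 ⥤ DGModule 𝒜 where
  obj := shift n
  map {M N} f :=
    { toLin := (lin f : M →ₗ[Aᵐᵒᵖ] N)
      map_gr := fun i m hm => f.map_gr (i + n) m hm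
      map_d := fun m => by
        have h1 : ∀ y : M, lin f (((n.negOnePow : ℤˣ) : ℤ) • M.d y) =
            ((n.negOnePow : ℤˣ) : ℤ) • N.d (lin f y) := fun y => by
          have h2 : lin f (M.d y) = N.d (lin f y) := f.map_d y
          rw [map_zsmul, h2]
        exact h1 m }

/-- The mapping cone `C(f) = Y ⊕ {1}X` with differential `(y, x) ↦ (d y + f x, - d x)`. -/
def cone {X Y : DGModule 𝒜} (f : X ⟶ Y) : DGModule 𝒜 where
  carrier := Y × X
  gr i := (Y.gr i).prod (X.gr (i + 1))
  isInternal := by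
    have hX := (shift 1 X).isInternal
    refine isInternal_of_proj
      (fun i => AddMonoidHom.prodMap (Y.proj i) ((shift 1 X).proj i)) ?_ ?_ ?_
    · rintro i ⟨y, x⟩ ⟨hy, hx⟩
      exact Prod.ext (gradedProj_of_mem _ hy) (gradedProj_of_mem hX hx)
    · rintro i j hij ⟨y, x⟩ ⟨hy, hx⟩
      exact Prod.ext (gradedProj_of_mem_ne _ hij hy) (gradedProj_of_mem_ne hX hij hx)
    · rintro ⟨y, x⟩
      have h1 : ⨆ i, Y.gr i ≤
          (⨆ i, (Y.gr i).prod (X.gr (i + 1))).comap (AddMonoidHom.inl Y X) :=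
        iSup_le fun i y hy => AddSubgroup.mem_iSup_of_mem i ⟨hy, zero_mem _⟩
      have h2 : ⨆ i, X.gr (i + 1) ≤
          (⨆ i, (Y.gr i).prod (X.gr (i + 1))).comap (AddMonoidHom.inr Y X) :=
        iSup_le fun i x hx => AddSubgroup.mem_iSup_of_mem i ⟨zero_mem _, hx⟩
      have h3 : (y, (0 : X)) ∈ ⨆ i, (Y.gr i).prod (X.gr (i + 1)) :=
        h1 (mem_iSup_of_isInternal Y.isInternal y)
      have h4 : ((0 : Y), x) ∈ ⨆ i, (Y.gr i).prod (X.gr (i + 1)) :=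
        h2 (mem_iSup_of_isInternal hX x)
      have := add_mem h3 h4
      rwa [Prod.mk_add_mk, add_zero, zero_add] at this
  smul_mem i j m hm a ha :=
    ⟨Y.smul_mem i j _ hm.1 a ha, (shift 1 X).smul_mem i j _ hm.2 a ha⟩
  d := AddMonoidHom.prod
    (Y.d.comp (AddMonoidHom.fst Y X) + (lin f).toAddMonoidHom.comp (AddMonoidHom.snd Y X))
    (-(X.d.comp (AddMonoidHom.snd Y X)))
  d_mem i m hm :=
    ⟨add_mem (Y.d_mem i _ hm.1) (f.map_gr _ _ hm.2), (X.gr _).neg_mem (X.d_mem _ _ hm.2)⟩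
  d_d m := by
    have h1 : lin f (X.d m.2) = Y.d (lin f m.2) := f.map_d m.2
    refine Prod.ext ?_ ?_
    · simp [Y.d_d, h1]
    · simp [X.d_d]
  leibniz i m hm a := by
    have h1 := Y.leibniz i _ hm.1 a
    have h2 := X.leibniz (i + 1) _ hm.2 a
    refine Prod.ext ?_ ?_
    · simp [h1]
      abel
    · simp [h2, Int.negOnePow_succ]
      abel

/-- The canonical morphism `Y → C(f)`. -/
def coneInl {X Y : DGModule 𝒜} (f : X ⟶ Y) : Y ⟶ cone f where
  toLin := LinearMap.inl Aᵐᵒᵖ Y X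
  map_gr _ _ hm := ⟨hm, zero_mem _⟩
  map_d m := by
    refine Prod.ext ?_ ?_
    · change Y.d m = Y.d m + lin f 0
      rw [map_zero, add_zero]
    · change (0 : X) = -X.d 0
      rw [map_zero, neg_zero]

/-- The canonical morphism `C(f) → {1}X`. -/
def coneSnd {X Y : DGModule 𝒜} (f : X ⟶ Y) : cone f ⟶ shift 1 X where
  toLin := LinearMap.snd Aᵐᵒᵖ Y X
  map_gr _ _ hm := hm.2
  map_d m := by
    change -X.d m.2 = (((1 : ℤ).negOnePow : ℤˣ) : ℤ) • X.d m.2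
    simp

end DGModule

/-- A dg submodule: a graded `A`-submodule that is stable under the differential. -/
@[ext]
structure DGSubmodule {𝒜 : DGAlgebra k A} (M : DGModule 𝒜) where
  /-- the underlying submodule -/
  sub : Submodule Aᵐᵒᵖ M
  proj_mem : ∀ (i : ℤ), ∀ m ∈ sub, M.proj i m ∈ sub
  d_mem : ∀ m ∈ sub, M.d m ∈ sub

namespace DGSubmodule

variable {𝒜 : DGAlgebra k A} {M : DGModule 𝒜}

/-- The dg module `P / N` for dg submodules `N ⊆ P` of `M` (in general, `P / (P ∩ N)`). -/
noncomputable def subquotient (N P : DGSubmodule M) : DGModule 𝒜 where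
  carrier := P.sub ⧸ N.sub.submoduleOf P.sub
  gr i := ((M.gr i).comap P.sub.subtype.toAddMonoidHom).map
    (N.sub.submoduleOf P.sub).mkQ.toAddMonoidHom
  isInternal := by
    refine isInternal_of_proj (fun i => quotientEnd _
      (((M.proj i).comp P.sub.subtype.toAddMonoidHom).codRestrict P.sub
        (fun x => P.proj_mem i _ x.2)) (fun x hx => N.proj_mem i _ hx)) ?_ ?_ ?_
    · rintro i _ ⟨x, hx, rfl⟩
      exact congrArg (N.sub.submoduleOf P.sub).mkQ (Subtype.ext (gradedProj_of_mem _ hx))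
    · rintro i j hij _ ⟨x, hx, rfl⟩
      exact (congrArg (N.sub.submoduleOf P.sub).mkQ
        (Subtype.ext (gradedProj_of_mem_ne _ hij hx))).trans (map_zero _)
    · intro x
      obtain ⟨x, rfl⟩ := (N.sub.submoduleOf P.sub).mkQ_surjective x
      classical
      obtain ⟨v, hv⟩ := M.isInternal.2 x
      have hc : ∀ i, (v i : M) ∈ P.sub := fun i => by
        rw [← gradedProj_coe M.isInternal i v, hv]
        exact P.proj_mem i _ x.2
      have hs : x = ∑ i ∈ DFinsupp.support v, (⟨v i, hc i⟩ : P.sub) := by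
        refine Subtype.ext ?_
        rw [← hv, DirectSum.coeAddMonoidHom_eq_dfinsuppSum, DFinsupp.sum]
        simp
      rw [hs, map_sum]
      exact sum_mem fun i _ => AddSubgroup.mem_iSup_of_mem i ⟨_, (v i).2, rfl⟩
  smul_mem := by
    rintro i j _ ⟨x, hx, rfl⟩ a ha
    exact ⟨MulOpposite.op a • x, M.smul_mem i j _ hx a ha, map_smul (N.sub.submoduleOf P.sub).mkQ _ _⟩
  d := quotientEnd _
      ((M.d.comp P.sub.subtype.toAddMonoidHom).codRestrict P.sub
        (fun x => P.d_mem _ x.2)) (fun x hx => N.d_mem _ hx)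
  d_mem := by
    rintro i _ ⟨x, hx, rfl⟩
    exact ⟨⟨M.d x, P.d_mem _ x.2⟩, M.d_mem i _ hx, rfl⟩
  d_d m := by
    obtain ⟨x, rfl⟩ := (N.sub.submoduleOf P.sub).mkQ_surjective m
    exact (congrArg (N.sub.submoduleOf P.sub).mkQ
      (Subtype.ext (M.d_d x) : (⟨M.d (M.d x), P.d_mem _ (P.d_mem _ x.2)⟩ : P.sub) = 0)).trans
        (map_zero _)
  leibniz := by
    rintro i _ ⟨x, hx, rfl⟩ a
    exact congrArg (N.sub.submoduleOf P.sub).mkQ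
      (Subtype.ext (M.leibniz i _ hx a) :
        (⟨M.d (MulOpposite.op a • (x : M)), P.d_mem _ (P.sub.smul_mem _ x.2)⟩ : P.sub) =
          MulOpposite.op a • ⟨M.d x, P.d_mem _ x.2⟩ +
            ((i.negOnePow : ℤˣ) : ℤ) • (MulOpposite.op (𝒜.d a) • x))

end DGSubmodule

section ExtensionOfScalars

open TensorProduct

variable (𝒜 : DGAlgebra k A) (L : Type v) [AddCommGroup L] [Module 𝒜.degZeroᵐᵒᵖ L]

/-- The relations `l b ⊗ a = l ⊗ b a` (`l ∈ L`, `b ∈ A^0`, `a ∈ A`) that define `L ⊗_{A^0} A` as a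
quotient of `L ⊗_ℤ A`. Mathlib's tensor products carry the module structure of the left factor, so
`L ⊗_ℤ A` is written as `A ⊗[ℤ] L`, and its element `l ⊗ a` as `a ⊗ₜ l`. -/
def balancedRel : Submodule Aᵐᵒᵖ (A ⊗[ℤ] L) :=
  Submodule.span Aᵐᵒᵖ {t | ∃ (l : L) (b : 𝒜.degZero) (a : A),
    t = a ⊗ₜ[ℤ] (MulOpposite.op b • l) - ((b : A) * a) ⊗ₜ[ℤ] l}

variable {L} in
theorem mem_balancedRel_of_mem {φ : A →+ A} (hφ : ∀ b ∈ 𝒜.gr 0, ∀ a, φ (b * a) = b * φ a)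
    {t : A ⊗[ℤ] L} (ht : t ∈ balancedRel 𝒜 L) :
    TensorProduct.map φ.toIntLinearMap (LinearMap.id : L →ₗ[ℤ] L) t ∈ balancedRel 𝒜 L := by
  induction ht using Submodule.closure_induction with
  | zero => simp
  | add x y _ _ hx hy => rw [map_add]; exact add_mem hx hy
  | smul_mem c x hx =>
    obtain ⟨l, b, a, rfl⟩ := hx
    refine Submodule.subset_span ⟨l, b, φ (c • a), ?_⟩
    rw [smul_sub, TensorProduct.smul_tmul', TensorProduct.smul_tmul', map_sub,
      TensorProduct.map_tmul, TensorProduct.map_tmul]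
    have : c • ((b : A) * a) = b * (c • a) := by
      simp [MulOpposite.smul_eq_mul_unop, mul_assoc]
    rw [this]
    simp [hφ _ b.2]

/-- The projection `A → A^i`, as an endomorphism of `A`. -/
noncomputable def DGAlgebra.proj (i : ℤ) : A →+ A :=
  gradedProj (gr := fun i => (𝒜.gr i).toAddSubgroup) 𝒜.isInternal i

theorem DGAlgebra.proj_mul (i : ℤ) (b : A) (hb : b ∈ 𝒜.gr 0) (a : A) :
    𝒜.proj i (b * a) = b * 𝒜.proj i a := by
  have ha := mem_iSup_of_isInternal (gr := fun i => (𝒜.gr i).toAddSubgroup) 𝒜.isInternal a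
  have hle : ⨆ j, (𝒜.gr j).toAddSubgroup ≤
      ((𝒜.proj i).comp (AddMonoidHom.mulLeft b)).eqLocus
        ((AddMonoidHom.mulLeft b).comp (𝒜.proj i)) := by
    refine iSup_le fun j a ha => ?_
    change 𝒜.proj i (b * a) = b * 𝒜.proj i a
    have hba : b * a ∈ (𝒜.gr j).toAddSubgroup := by
      have := SetLike.mul_mem_graded hb (show a ∈ 𝒜.gr j from ha)
      rwa [zero_add] at this
    by_cases hij : i = j
    · subst hij
      exact (gradedProj_of_mem _ hba).trans (congrArg (b * ·) (gradedProj_of_mem _ ha)).symm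
    · refine (gradedProj_of_mem_ne _ hij hba).trans ?_
      have : 𝒜.proj i a = 0 := gradedProj_of_mem_ne _ hij ha
      rw [this, mul_zero]
  exact hle ha

/-- The dg module `L ⊗_{A^0} A` (extension of scalars along `A^0 ⊆ A`), for a right `A^0`-module
`L` placed in degree zero: its component of degree `i` is spanned by the `l ⊗ a` with `a ∈ A^i`,
and `d(l ⊗ a) = l ⊗ d a`. This is well defined because `d(A^0) = 0`. -/
noncomputable def DGAlgebra.hat (h𝒜 : ∀ a ∈ 𝒜.gr 0, 𝒜.d a = 0) : DGModule 𝒜 where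
  carrier := (A ⊗[ℤ] L) ⧸ balancedRel 𝒜 L
  gr i := AddSubgroup.closure
    {x | ∃ a ∈ 𝒜.gr i, ∃ l : L, x = (balancedRel 𝒜 L).mkQ (a ⊗ₜ[ℤ] l)}
  isInternal := by
    refine isInternal_of_proj (fun i => quotientEnd _
      (TensorProduct.map (𝒜.proj i).toIntLinearMap (LinearMap.id : L →ₗ[ℤ] L)).toAddMonoidHom
      (fun t ht => mem_balancedRel_of_mem 𝒜 (𝒜.proj_mul i) ht)) ?_ ?_ ?_
    · intro i x hx
      induction hx using AddSubgroup.closure_induction with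
      | mem x hx =>
        obtain ⟨a, ha, l, rfl⟩ := hx
        have : 𝒜.proj i a = a := gradedProj_of_mem _ ha
        exact congrArg (fun b => (balancedRel 𝒜 L).mkQ (b ⊗ₜ[ℤ] l)) this
      | zero => exact map_zero _
      | add x y _ _ hx hy => rw [map_add, hx, hy]
      | neg x _ hx => rw [map_neg, hx]
    · intro i j hij x hx
      induction hx using AddSubgroup.closure_induction with
      | mem x hx =>
        obtain ⟨a, ha, l, rfl⟩ := hx
        have : 𝒜.proj i a = 0 := gradedProj_of_mem_ne _ hij ha
        refine (congrArg (fun b => (balancedRel 𝒜 L).mkQ (b ⊗ₜ[ℤ] l)) this).trans ?_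
        simp only [TensorProduct.zero_tmul, map_zero]
      | zero => exact map_zero _
      | add x y _ _ hx hy => rw [map_add, hx, hy, add_zero]
      | neg x _ hx => rw [map_neg, hx, neg_zero]
    · intro x
      obtain ⟨t, rfl⟩ := (balancedRel 𝒜 L).mkQ_surjective x
      induction t using TensorProduct.induction_on with
      | zero => rw [map_zero]; exact zero_mem _
      | add x y hx hy => rw [map_add]; exact add_mem hx hy
      | tmul a l =>
        have ha := mem_iSup_of_isInternal (gr := fun i => (𝒜.gr i).toAddSubgroup)
          𝒜.isInternal a
        have hle : ⨆ j, (𝒜.gr j).toAddSubgroup ≤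
            (⨆ i, AddSubgroup.closure
              {x | ∃ a ∈ 𝒜.gr i, ∃ l : L, x = (balancedRel 𝒜 L).mkQ (a ⊗ₜ[ℤ] l)}).comap
            ((balancedRel 𝒜 L).mkQ.toAddMonoidHom.comp
              ((TensorProduct.mk ℤ A L).flip l).toAddMonoidHom) :=
          iSup_le fun j a ha => AddSubgroup.mem_iSup_of_mem j
            (AddSubgroup.subset_closure ⟨a, ha, l, rfl⟩)
        exact hle ha
  smul_mem i j m hm a ha := by
    induction hm using AddSubgroup.closure_induction with
    | mem x hx =>
      obtain ⟨b, hb, l, rfl⟩ := hx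
      refine AddSubgroup.subset_closure ⟨b * a, SetLike.mul_mem_graded hb ha, l, ?_⟩
      rw [← map_smul, TensorProduct.smul_tmul', op_smul_eq_mul]
    | zero => rw [smul_zero]; exact zero_mem _
    | add x y _ _ hx hy => rw [smul_add]; exact add_mem hx hy
    | neg x _ hx => rw [smul_neg]; exact neg_mem hx
  d := quotientEnd _
    (TensorProduct.map 𝒜.d.toAddMonoidHom.toIntLinearMap
      (LinearMap.id : L →ₗ[ℤ] L)).toAddMonoidHom
    (fun t ht => mem_balancedRel_of_mem 𝒜 (φ := 𝒜.d.toAddMonoidHom) (fun b hb a => by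
      change 𝒜.d (b * a) = b * 𝒜.d a
      rw [𝒜.leibniz 0 b hb a, h𝒜 b hb]
      simp) ht)
  d_mem i m hm := by
    induction hm using AddSubgroup.closure_induction with
    | mem x hx =>
      obtain ⟨b, hb, l, rfl⟩ := hx
      exact AddSubgroup.subset_closure ⟨𝒜.d b, 𝒜.d_mem i b hb, l, rfl⟩
    | zero => rw [map_zero]; exact zero_mem _
    | add x y _ _ hx hy => rw [map_add]; exact add_mem hx hy
    | neg x _ hx => rw [map_neg]; exact neg_mem hx
  d_d m := by
    obtain ⟨t, rfl⟩ := (balancedRel 𝒜 L).mkQ_surjective m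
    induction t using TensorProduct.induction_on with
    | zero => simp only [map_zero]
    | add x y hx hy => simp only [map_add, hx, hy, add_zero]
    | tmul a l =>
      refine (congrArg (fun b => (balancedRel 𝒜 L).mkQ (b ⊗ₜ[ℤ] l)) (𝒜.d_d a)).trans ?_
      simp only [TensorProduct.zero_tmul, map_zero]
  leibniz i m hm a := by
    induction hm using AddSubgroup.closure_induction with
    | mem x hx =>
      obtain ⟨b, hb, l, rfl⟩ := hx
      refine (congrArg (fun b => (balancedRel 𝒜 L).mkQ (b ⊗ₜ[ℤ] l))
        (𝒜.leibniz i b hb a)).trans ?_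
      simp only [TensorProduct.add_tmul, map_add]
      congr 1
    | zero => simp only [smul_zero, map_zero, add_zero]
    | add x y _ _ hx hy =>
      simp only [smul_add, map_add, hx, hy]
      abel
    | neg x _ hx =>
      simp only [smul_neg, map_neg, hx, neg_add]

end ExtensionOfScalars

/-- The homotopy category `dgHot(𝒜)`: dg modules, with homotopy classes of morphisms. -/
abbrev DGHot (𝒜 : DGAlgebra k A) := CategoryTheory.Quotient (DGModule.Homotopic (𝒜 := 𝒜))

namespace DGHot

variable {𝒜 : DGAlgebra k A}

/-- The quotient functor `dgMod(𝒜) ⥤ dgHot(𝒜)`. -/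
abbrev quot : DGModule 𝒜 ⥤ DGHot 𝒜 := CategoryTheory.Quotient.functor _

/-- The shift functor `{n}` on `dgHot(𝒜)`. -/
def shiftFunctor (n : ℤ) : DGHot 𝒜 ⥤ DGHot 𝒜 :=
  CategoryTheory.Quotient.lift _ (DGModule.shiftFunctor n ⋙ quot) (by
    rintro X Y f g ⟨h, hd, hh⟩
    refine CategoryTheory.Quotient.sound _
      ⟨((n.negOnePow : ℤˣ) : ℤ) • h, fun i m hm => ?_, fun m => ?_⟩
    · have := hd (i + n) m hm
      rw [add_sub_right_comm] at this
      exact (Y.gr _).zsmul_mem this _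
    · have hs : ((n.negOnePow : ℤˣ) : ℤ) * ((n.negOnePow : ℤˣ) : ℤ) = 1 := by
        rw [← Units.val_mul, ← Int.negOnePow_add, Int.negOnePow_even _ (Even.add_self n),
          Units.val_one]
      refine (hh m).trans ?_
      change Y.d (h m) + h (X.d m) =
        ((n.negOnePow : ℤˣ) : ℤ) • Y.d (((n.negOnePow : ℤˣ) : ℤ) • h m) +
          ((n.negOnePow : ℤˣ) : ℤ) • h (((n.negOnePow : ℤˣ) : ℤ) • X.d m)
      rw [map_zsmul, map_zsmul, smul_smul, smul_smul, hs, one_smul, one_smul])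

/-- The triangle `X → Y → Z → {1}X` in `dgHot(𝒜)` is distinguished: it is isomorphic to the
standard triangle `X' → Y' → C(φ) → {1}X'` of a morphism `φ` of dg modules. -/
def IsDistinguished {X Y Z : DGHot 𝒜} (f : X ⟶ Y) (g : Y ⟶ Z)
    (h : Z ⟶ (shiftFunctor 1).obj X) : Prop :=
  ∃ (X' Y' : DGModule 𝒜) (φ : X' ⟶ Y') (a : X ≅ quot.obj X') (b : Y ≅ quot.obj Y')
    (c : Z ≅ quot.obj (DGModule.cone φ)),
    f ≫ b.hom = a.hom ≫ quot.map φ ∧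
    g ≫ c.hom = b.hom ≫ quot.map (DGModule.coneInl φ) ∧
    h ≫ (shiftFunctor 1).map a.hom = c.hom ≫ quot.map (DGModule.coneSnd φ)

/-- The full subcategory of `dgHot(𝒜)` on the objects satisfying `P` is a strict full triangulated
subcategory: it contains zero objects, and is closed under isomorphisms, shifts, and the third
vertex of a distinguished triangle. -/
structure IsStrictTriangulated (P : ObjectProperty (DGHot 𝒜)) : Prop where
  zero : P.ContainsZero
  iso : P.IsClosedUnderIsomorphisms
  shift : ∀ (n : ℤ) (X : DGHot 𝒜), P X → P ((shiftFunctor n).obj X)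
  third : ∀ {X Y Z : DGHot 𝒜} (f : X ⟶ Y) (g : Y ⟶ Z) (h : Z ⟶ (shiftFunctor 1).obj X),
    IsDistinguished f g h → P X → P Y → P Z

end DGHot

/-- `(L x)` for `x ∈ W` is a system of representatives of the isomorphism classes of simple right
modules over the ring `R`. -/
structure IsSimpleSystem (R : Type v) [Ring R] {W : Type*} (L : W → Type v)
    [∀ x, AddCommGroup (L x)] [∀ x, Module Rᵐᵒᵖ (L x)] : Prop where
  simple : ∀ x, IsSimpleModule Rᵐᵒᵖ (L x)
  eq_of_iso : ∀ x y, Nonempty (L x ≃ₗ[Rᵐᵒᵖ] L y) → x = y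
  exists_iso : ∀ (S : Type v) [AddCommGroup S] [Module Rᵐᵒᵖ S], IsSimpleModule Rᵐᵒᵖ S →
    ∃ x, Nonempty (S ≃ₗ[Rᵐᵒᵖ] L x)

section Subcategories

variable {𝒜 : DGAlgebra k A} (h𝒜 : 𝒜.IsPositiveSemisimple) {W : Type*} (L : W → Type v)
  [∀ x, AddCommGroup (L x)] [∀ x, Module 𝒜.degZeroᵐᵒᵖ (L x)]

/-- `M` admits a finite filtration `0 = F_0 ⊆ F_1 ⊆ ⋯ ⊆ F_n = M` by dg submodules with
`F_i / F_{i-1} ≅ {l_i} L̂_{x_i}` in `dgMod(𝒜)` and `l_1 ≥ ⋯ ≥ l_n`. -/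
def HasHatFiltration (M : DGModule 𝒜) : Prop :=
  ∃ (n : ℕ) (F : Fin (n + 1) → DGSubmodule M) (l : Fin n → ℤ) (x : Fin n → W),
    (F 0).sub = ⊥ ∧ (F (Fin.last n)).sub = ⊤ ∧ Antitone l ∧
    ∀ i : Fin n, (F i.castSucc).sub ≤ (F i.succ).sub ∧
      Nonempty (DGSubmodule.subquotient (F i.castSucc) (F i.succ) ≅
        DGModule.shift (l i) (𝒜.hat (L (x i)) h𝒜.d_degZero))

/-- The objects of `dgFilt(𝒜)`, as a full subcategory of `dgHot(𝒜)`. -/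
def dgFilt : ObjectProperty (DGHot 𝒜) := fun X => HasHatFiltration h𝒜 L X.as

/-- The objects of `dgPrae(𝒜)`, the smallest strict full triangulated subcategory of `dgHot(𝒜)`
that contains all `L̂_x`. -/
def dgPrae : ObjectProperty (DGHot 𝒜) := fun X =>
  ∀ P : ObjectProperty (DGHot 𝒜), DGHot.IsStrictTriangulated P →
    (∀ x, P (DGHot.quot.obj (𝒜.hat (L x) h𝒜.d_degZero))) → P X

end Subcategories

end

/-! Because the modules `L̂_x` are projective as graded modules, a filtration with subquotients
`{l} L̂_x` presents a dg module as an iterated mapping cone of morphisms from the `{l - 1} L̂_x`,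
with decreasing `l`; conversely, such an iterated cone is filtered by its stages. The point is to
reorder cells that are attached in the wrong order. Since `A` vanishes in negative degrees, Schur's
lemma shows that a morphism `{p} L̂_x → {q} L̂_y` with `q ≤ p` is zero or an isomorphism. If a cell
is attached on top of a cell of smaller shift, then the component of its attaching morphism between
the two cells is of this kind: if it is zero, then the two cells can be interchanged, and if it is
an isomorphism, then they cancel up to homotopy equivalence. Hence the dg modules that are homotopy
equivalent to a filtered one are closed under mapping cones. -/

namespace DGModule

variable {k : Type u} [CommRing k] {A : Type v} [Ring A] [Algebra k A] {𝒜 : DGAlgebra k A}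
  {M N P : DGModule 𝒜}

@[simp]
theorem lin_id (m : M) : lin (𝟙 M) m = m := rfl

@[simp]
theorem lin_comp (f : M ⟶ N) (g : N ⟶ P) (m : M) : lin (f ≫ g) m = lin g (lin f m) := rfl

theorem lin_d (f : M ⟶ N) (m : M) : lin f (M.d m) = N.d (lin f m) := f.map_d m

theorem lin_mem (f : M ⟶ N) {i : ℤ} {m : M} (hm : m ∈ M.gr i) : lin f m ∈ N.gr i :=
  f.map_gr i m hm

theorem ext_apply {f g : M ⟶ N} (h : ∀ m, lin f m = lin g m) : f = g :=
  hom_ext (LinearMap.ext h)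

theorem proj_mem (M : DGModule 𝒜) (i : ℤ) (m : M) : M.proj i m ∈ M.gr i :=
  gradedProj_mem _ _ _

theorem proj_of_mem {i : ℤ} {m : M} (hm : m ∈ M.gr i) : M.proj i m = m :=
  gradedProj_of_mem _ hm

theorem proj_of_mem_ne {i j : ℤ} (hij : i ≠ j) {m : M} (hm : m ∈ M.gr j) : M.proj i m = 0 :=
  gradedProj_of_mem_ne _ hij hm

theorem gr_induction {p : M → Prop} (zero : p 0) (add : ∀ x y, p x → p y → p (x + y))
    (mem : ∀ i, ∀ m ∈ M.gr i, p m) (m : M) : p m := by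
  have h := mem_iSup_of_isInternal M.isInternal m
  induction h using AddSubgroup.iSup_induction' with
  | hp i x hx => exact mem i x hx
  | h1 => exact zero
  | hadd x y _ _ hx hy => exact add x y hx hy

theorem map_proj (f : M →+ N) (hf : ∀ i, ∀ m ∈ M.gr i, f m ∈ N.gr i) (i : ℤ) (m : M) :
    f (M.proj i m) = N.proj i (f m) := by
  induction m using gr_induction with
  | zero => simp only [map_zero]
  | add x y hx hy => simp only [map_add, hx, hy]
  | mem j m hm =>
    rcases eq_or_ne i j with rfl | hij
    · rw [proj_of_mem hm, proj_of_mem (hf _ _ hm)]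
    · rw [proj_of_mem_ne hij hm, proj_of_mem_ne hij (hf _ _ hm), map_zero]

theorem lin_proj (f : M ⟶ N) (i : ℤ) (m : M) : lin f (M.proj i m) = N.proj i (lin f m) :=
  map_proj (lin f).toAddMonoidHom (fun _ _ hm => lin_mem f hm) i m

theorem mem_gr_of_lin_mem {f : M ⟶ N} (hf : Function.Injective (lin f)) {i : ℤ} {m : M}
    (hm : lin f m ∈ N.gr i) : m ∈ M.gr i := by
  have hproj : M.proj i m = m := hf (by rw [lin_proj, proj_of_mem hm])
  exact hproj ▸ M.proj_mem i m

theorem isIso_of_bijective (f : M ⟶ N) (hf : Function.Bijective (lin f)) : IsIso f := by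
  let e := LinearEquiv.ofBijective (lin f) hf
  have he : ∀ n, lin f (e.symm n) = n := e.apply_symm_apply
  let g : N ⟶ M :=
    { toLin := e.symm.toLinearMap
      map_gr := fun i n hn => mem_gr_of_lin_mem hf.1 ((he n).symm ▸ hn)
      map_d := fun n => hf.1 (by
        rw [LinearEquiv.coe_coe, he, lin_d, he]) }
  exact ⟨g, ext_apply e.symm_apply_apply, ext_apply he⟩

theorem nonempty_iso_of_linearEquiv (e : M ≃ₗ[Aᵐᵒᵖ] N)
    (hgr : ∀ i, ∀ m ∈ M.gr i, e m ∈ N.gr i) (hd : ∀ m, e (M.d m) = N.d (e m)) :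
    Nonempty (M ≅ N) := by
  let f : M ⟶ N := { toLin := e.toLinearMap, map_gr := hgr, map_d := hd }
  have := isIso_of_bijective f e.bijective
  exact ⟨asIso f⟩

theorem lin_bijective (f : M ⟶ N) [IsIso f] : Function.Bijective (lin f) :=
  Function.bijective_iff_has_inverse.2 ⟨lin (inv f),
    fun m => by rw [← lin_comp, IsIso.hom_inv_id, lin_id],
    fun n => by rw [← lin_comp, IsIso.inv_hom_id, lin_id]⟩

theorem nonempty_iso_shift_shift {a b c : ℤ} (h : a + b = c) (M : DGModule 𝒜) :
    Nonempty (shift a (shift b M) ≅ shift c M) := by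
  subst h
  refine nonempty_iso_of_linearEquiv (LinearEquiv.refl Aᵐᵒᵖ M) (fun i m hm => ?_) (fun m => ?_)
  · change m ∈ M.gr (i + (a + b))
    rw [← add_assoc]
    exact hm
  · change ((a.negOnePow : ℤˣ) : ℤ) • ((b.negOnePow : ℤˣ) : ℤ) • M.d m =
      (((a + b).negOnePow : ℤˣ) : ℤ) • M.d m
    rw [Int.negOnePow_add, Units.val_mul, smul_smul]

theorem nonempty_iso_shift_zero (M : DGModule 𝒜) : Nonempty (shift 0 M ≅ M) := by
  refine nonempty_iso_of_linearEquiv (LinearEquiv.refl Aᵐᵒᵖ M) (fun i m hm => ?_) (fun m => ?_)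
  · rw [← add_zero i]
    exact hm
  · change (((0 : ℤ).negOnePow : ℤˣ) : ℤ) • M.d m = M.d m
    rw [Int.negOnePow_zero, Units.val_one, one_smul]

variable (𝒜) in
/-- The zero dg module. -/
def zeroModule : DGModule 𝒜 where
  carrier := PUnit
  gr _ := ⊤
  isInternal := isInternal_of_proj (fun _ => 0) (fun _ _ _ => rfl) (fun _ _ _ _ _ => rfl)
    (fun x => (Subsingleton.elim 0 x) ▸ zero_mem _)
  smul_mem _ _ _ _ _ _ := trivial
  d := 0
  d_mem _ _ _ := trivial
  d_d _ := rfl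
  leibniz _ _ _ _ := rfl

instance : Subsingleton (zeroModule 𝒜) := inferInstanceAs (Subsingleton PUnit)

/-- The zero morphism of dg modules. -/
def zeroHom (M N : DGModule 𝒜) : M ⟶ N where
  toLin := 0
  map_gr _ _ _ := zero_mem _
  map_d _ := (map_zero N.d).symm

@[simp]
theorem lin_zeroHom (m : M) : lin (zeroHom M N) m = 0 := rfl

theorem isZero_quot_of_subsingleton (M : DGModule 𝒜) [Subsingleton M] :
    Limits.IsZero (DGHot.quot.obj M) := by
  refine ⟨fun Y => ⟨⟨⟨DGHot.quot.map (zeroHom M Y.as)⟩, fun f => ?_⟩⟩,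
    fun Y => ⟨⟨⟨DGHot.quot.map (zeroHom Y.as M)⟩, fun f => ?_⟩⟩⟩
  · obtain ⟨f, rfl⟩ := DGHot.quot.map_surjective (Y := Y.as) f
    refine congrArg DGHot.quot.map (ext_apply fun m => ?_)
    rw [Subsingleton.elim m 0, map_zero, map_zero]
  · obtain ⟨f, rfl⟩ := DGHot.quot.map_surjective (X := Y.as) f
    exact congrArg DGHot.quot.map (ext_apply fun m => Subsingleton.elim (α := M) _ _)

end DGModule

theorem isIso_of_isIso_comp_comp {C : Type*} [Category C] {X Y : C} (f : X ⟶ Y) (g : Y ⟶ X)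
    [IsIso (f ≫ g)] [IsIso (g ≫ f)] : IsIso f := by
  have : Mono f := mono_of_mono f g
  have : IsSplitEpi f := .mk' ⟨inv (g ≫ f) ≫ g, by rw [Category.assoc, IsIso.inv_hom_id]⟩
  exact isIso_of_mono_of_isSplitEpi f

namespace DGModule

variable {k : Type u} [CommRing k] {A : Type v} [Ring A] [Algebra k A] {𝒜 : DGAlgebra k A}

/-- `h` is a homotopy from `f` to `g`: an `A`-linear map of degree `-1` with
`f - g = d h + h d`. -/
structure IsHomotopy {M N : DGModule 𝒜} (f g : M ⟶ N) (h : M →ₗ[Aᵐᵒᵖ] N) : Prop where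
  mem : ∀ (i : ℤ), ∀ m ∈ M.gr i, h m ∈ N.gr (i - 1)
  sub_eq : ∀ m, lin f m - lin g m = N.d (h m) + h (M.d m)

theorem quot_map_eq_iff {M N : DGModule 𝒜} {f g : M ⟶ N} :
    DGHot.quot.map f = DGHot.quot.map g ↔ ∃ h, IsHomotopy f g h := by
  rw [CategoryTheory.Quotient.functor_map_eq_iff]
  exact ⟨fun ⟨h, hmem, heq⟩ => ⟨h, hmem, heq⟩, fun ⟨h, hh⟩ => ⟨h, hh.mem, hh.sub_eq⟩⟩

section Cone

variable {X Y X' Y' Z : DGModule 𝒜}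

/-- The morphism `C(φ) → Z`, `(y, x) ↦ g y + s x`, determined by a morphism `g : Y → Z` and a
nullhomotopy `s` of its composition with `φ : X → Y`. -/
def coneDesc (φ : X ⟶ Y) (g : Y ⟶ Z) (s : X →ₗ[Aᵐᵒᵖ] Z)
    (hs : IsHomotopy (φ ≫ g) (zeroHom X Z) s) : cone φ ⟶ Z where
  toLin := LinearMap.coprod (lin g) s
  map_gr i m hm := add_mem (lin_mem g hm.1) (by
    rw [← add_sub_cancel_right i 1]
    exact hs.mem _ _ hm.2)
  map_d := by
    rintro ⟨y, x⟩
    have hsx : lin g (lin φ x) - 0 = Z.d (s x) + s (X.d x) := hs.sub_eq x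
    change lin g (Y.d y + lin φ x) + s (-X.d x) = Z.d (lin g y + s x)
    rw [map_add, map_add, map_neg, lin_d, sub_eq_iff_eq_add.1 hsx]
    abel

theorem IsHomotopy.prod_coneInl {φ : X ⟶ Y} {φ' : X' ⟶ Y'} {a : X ⟶ X'} {b : Y ⟶ Y'}
    {s : X →ₗ[Aᵐᵒᵖ] Y'} (hs : IsHomotopy (φ ≫ b) (a ≫ φ') s) :
    IsHomotopy (φ ≫ b ≫ coneInl φ') (zeroHom X (cone φ')) (LinearMap.prod s (lin a)) where
  mem i x hx := ⟨hs.mem i x hx, by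
    rw [sub_add_cancel]
    exact lin_mem a hx⟩
  sub_eq x := by
    have hsx : lin b (lin φ x) - lin φ' (lin a x) = Y'.d (s x) + s (X.d x) := hs.sub_eq x
    refine Prod.ext ?_ ?_
    · change lin b (lin φ x) - 0 = Y'.d (s x) + lin φ' (lin a x) + s (X.d x)
      rw [sub_zero, sub_eq_iff_eq_add.1 hsx, add_right_comm]
    · change (0 : X') - 0 = -X'.d (lin a x) + lin a (X.d x)
      rw [lin_d, sub_self, neg_add_cancel]

/-- The morphism of mapping cones induced by a square that commutes up to a homotopy `s`. -/
def coneMap {φ : X ⟶ Y} {φ' : X' ⟶ Y'} {a : X ⟶ X'} {b : Y ⟶ Y'} {s : X →ₗ[Aᵐᵒᵖ] Y'}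
    (hs : IsHomotopy (φ ≫ b) (a ≫ φ') s) : cone φ ⟶ cone φ' :=
  coneDesc φ (b ≫ coneInl φ') (LinearMap.prod s (lin a)) hs.prod_coneInl

theorem lin_coneMap {φ : X ⟶ Y} {φ' : X' ⟶ Y'} {a : X ⟶ X'} {b : Y ⟶ Y'} {s : X →ₗ[Aᵐᵒᵖ] Y'}
    (hs : IsHomotopy (φ ≫ b) (a ≫ φ') s) (m : Y × X) :
    lin (coneMap hs) m = ((lin b m.1 + s m.2, lin a m.2) : Y' × X') :=
  Prod.ext rfl (zero_add (lin a m.2))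

theorem isIso_coneMap {φ : X ⟶ Y} {φ' : X' ⟶ Y'} {a : X ⟶ X'} {b : Y ⟶ Y'} [IsIso a] [IsIso b]
    {s : X →ₗ[Aᵐᵒᵖ] Y'} (hs : IsHomotopy (φ ≫ b) (a ≫ φ') s) : IsIso (coneMap hs) := by
  refine isIso_of_bijective _ ⟨?_, ?_⟩
  · rintro ⟨y₁, x₁⟩ ⟨y₂, x₂⟩ h
    obtain ⟨hy, hx⟩ := Prod.ext_iff.1 ((lin_coneMap hs _).symm.trans (h.trans (lin_coneMap hs _)))
    obtain rfl : x₁ = x₂ := (lin_bijective a).1 hx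
    obtain rfl : y₁ = y₂ := (lin_bijective b).1 (add_right_cancel hy)
    rfl
  · rintro ⟨y', x'⟩
    obtain ⟨x, rfl⟩ := (lin_bijective a).2 x'
    obtain ⟨y, hy⟩ := (lin_bijective b).2 (y' - s x)
    refine ⟨((y, x) : Y × X), (lin_coneMap hs _).trans (Prod.ext ?_ rfl)⟩
    exact sub_eq_iff_eq_add.1 hy.symm |>.symm

theorem nonempty_iso_cone {φ : X ⟶ Y} {φ' : X' ⟶ Y'} (a : X ≅ X') (b : Y ≅ Y')
    (h : φ ≫ b.hom = a.hom ≫ φ') : Nonempty (cone φ ≅ cone φ') := by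
  have hs : IsHomotopy (φ ≫ b.hom) (a.hom ≫ φ') 0 :=
    { mem := fun _ _ _ => zero_mem _
      sub_eq := fun x => by simp only [h, sub_self, LinearMap.zero_apply, map_zero, add_zero] }
  have := isIso_coneMap hs
  exact ⟨asIso (coneMap hs)⟩

theorem exists_isHomotopy_coneMap_comp {X'' Y'' : DGModule 𝒜} {φ : X ⟶ Y} {φ' : X' ⟶ Y'}
    {φ'' : X'' ⟶ Y''} {a : X ⟶ X'} {b : Y ⟶ Y'} {a' : X' ⟶ X''} {b' : Y' ⟶ Y''}
    {s : X →ₗ[Aᵐᵒᵖ] Y'} {s' : X' →ₗ[Aᵐᵒᵖ] Y''} (hs : IsHomotopy (φ ≫ b) (a ≫ φ') s)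
    (hs' : IsHomotopy (φ' ≫ b') (a' ≫ φ'') s') :
    ∃ (t : X →ₗ[Aᵐᵒᵖ] Y'') (ht : IsHomotopy (φ ≫ b ≫ b') ((a ≫ a') ≫ φ'') t),
      coneMap hs ≫ coneMap hs' = coneMap ht := by
  refine ⟨(lin b').comp s + s'.comp (lin a), ⟨fun i x hx => ?_, fun x => ?_⟩, ?_⟩
  · exact add_mem (lin_mem b' (hs.mem i x hx)) (hs'.mem i _ (lin_mem a hx))
  · have h := congrArg (lin b') (hs.sub_eq x)
    have h' := hs'.sub_eq (lin a x)
    simp only [lin_comp, map_sub, map_add, LinearMap.add_apply, LinearMap.comp_apply, lin_d]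
      at h h' ⊢
    rw [← sub_add_sub_cancel _ (lin b' (lin φ' (lin a x))), h, h']
    abel
  · refine ext_apply fun ⟨y, x⟩ => (congrArg (lin (coneMap hs')) (lin_coneMap hs (y, x))).trans
      ((lin_coneMap hs' _).trans (Eq.trans ?_ (lin_coneMap _ (y, x)).symm))
    refine Prod.ext ?_ rfl
    change lin b' (lin b y + s x) + s' (lin a x) =
      lin b' (lin b y) + (lin b' (s x) + s' (lin a x))
    rw [map_add, add_assoc]

theorem IsHomotopy.of_isHomotopy {φ : X ⟶ Y} {φ' : X' ⟶ Y'} {a a' : X ⟶ X'} {b b' : Y ⟶ Y'}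
    {s : X →ₗ[Aᵐᵒᵖ] Y'} {p : X →ₗ[Aᵐᵒᵖ] X'} {q : Y →ₗ[Aᵐᵒᵖ] Y'}
    (hs : IsHomotopy (φ ≫ b) (a ≫ φ') s) (hp : IsHomotopy a a' p) (hq : IsHomotopy b b' q) :
    IsHomotopy (φ ≫ b') (a' ≫ φ') (s - q.comp (lin φ) + (lin φ').comp p) where
  mem i x hx := add_mem (sub_mem (hs.mem i x hx) (hq.mem i _ (lin_mem φ hx)))
    (lin_mem φ' (hp.mem i x hx))
  sub_eq x := by
    have h₁ := hs.sub_eq x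
    have h₂ := congrArg (lin φ') (hp.sub_eq x)
    have h₃ := hq.sub_eq (lin φ x)
    simp only [lin_comp, map_sub, map_add, LinearMap.add_apply, LinearMap.sub_apply,
      LinearMap.comp_apply, lin_d] at h₁ h₂ h₃ ⊢
    calc lin b' (lin φ x) - lin φ' (lin a' x)
        = (lin b (lin φ x) - lin φ' (lin a x)) - (lin b (lin φ x) - lin b' (lin φ x)) +
            (lin φ' (lin a x) - lin φ' (lin a' x)) := by abel
      _ = _ := by
        rw [h₁, h₂, h₃]
        abel

theorem quot_map_coneMap_eq {φ : X ⟶ Y} {φ' : X' ⟶ Y'} {a a' : X ⟶ X'} {b b' : Y ⟶ Y'}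
    {s : X →ₗ[Aᵐᵒᵖ] Y'} {p : X →ₗ[Aᵐᵒᵖ] X'} {q : Y →ₗ[Aᵐᵒᵖ] Y'}
    (hs : IsHomotopy (φ ≫ b) (a ≫ φ') s) (hp : IsHomotopy a a' p) (hq : IsHomotopy b b' q) :
    DGHot.quot.map (coneMap hs) = DGHot.quot.map (coneMap (hs.of_isHomotopy hp hq)) := by
  let H : cone φ →ₗ[Aᵐᵒᵖ] cone φ' := LinearMap.prodMap q (-p)
  refine quot_map_eq_iff.2 ⟨H, fun i m hm => ⟨hq.mem _ _ hm.1, ?_⟩, fun ⟨y, x⟩ => ?_⟩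
  · rw [← add_sub_right_comm]
    exact (X'.gr _).neg_mem (hp.mem _ _ hm.2)
  · refine (congrArg₂ (· - ·) (lin_coneMap hs (y, x)) (lin_coneMap _ (y, x))).trans
      (Prod.ext ?_ ?_)
    · change lin b y + s x - (lin b' y + (s x - q (lin φ x) + lin φ' (p x))) =
        Y'.d (q y) + lin φ' (-p x) + q (Y.d y + lin φ x)
      rw [sub_eq_iff_eq_add.1 (hq.sub_eq y), map_neg, map_add]
      abel
    · change lin a x - lin a' x = -X'.d (-p x) + -p (-X.d x)
      rw [map_neg, map_neg, neg_neg, neg_neg]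
      exact hp.sub_eq x

theorem isIso_quot_map_coneMap_of_eq_id {φ : X ⟶ Y} {a : X ⟶ X} {b : Y ⟶ Y}
    {s : X →ₗ[Aᵐᵒᵖ] Y} (hs : IsHomotopy (φ ≫ b) (a ≫ φ) s)
    (ha : DGHot.quot.map a = DGHot.quot.map (𝟙 X)) (hb : DGHot.quot.map b = DGHot.quot.map (𝟙 Y)) :
    IsIso (DGHot.quot.map (coneMap hs)) := by
  obtain ⟨p, hp⟩ := quot_map_eq_iff.1 ha
  obtain ⟨q, hq⟩ := quot_map_eq_iff.1 hb
  have := isIso_coneMap (hs.of_isHomotopy hp hq)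
  rw [quot_map_coneMap_eq hs hp hq]
  infer_instance

theorem isIso_quot_map_coneMap {φ : X ⟶ Y} {φ' : X' ⟶ Y'} {a : X ⟶ X'} {b : Y ⟶ Y'}
    {s : X →ₗ[Aᵐᵒᵖ] Y'} (hs : IsHomotopy (φ ≫ b) (a ≫ φ') s) [IsIso (DGHot.quot.map a)]
    [IsIso (DGHot.quot.map b)] : IsIso (DGHot.quot.map (coneMap hs)) := by
  obtain ⟨a', ha'⟩ := DGHot.quot.map_surjective (inv (DGHot.quot.map a))
  obtain ⟨b', hb'⟩ := DGHot.quot.map_surjective (inv (DGHot.quot.map b))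
  have hsq : DGHot.quot.map (φ ≫ b) = DGHot.quot.map (a ≫ φ') := quot_map_eq_iff.2 ⟨s, hs⟩
  obtain ⟨t, ht⟩ := quot_map_eq_iff.1 (show DGHot.quot.map (φ' ≫ b') = DGHot.quot.map (a' ≫ φ) by
    rw [Functor.map_comp, Functor.map_comp] at hsq ⊢
    rw [ha', hb', IsIso.comp_inv_eq, Category.assoc, hsq, IsIso.inv_hom_id_assoc])
  obtain ⟨u, hu, hcomp⟩ := exists_isHomotopy_coneMap_comp hs ht
  obtain ⟨w, hw, hcomp'⟩ := exists_isHomotopy_coneMap_comp ht hs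
  have h₁ := isIso_quot_map_coneMap_of_eq_id hu
    (by rw [Functor.map_comp, ha', IsIso.hom_inv_id, CategoryTheory.Functor.map_id])
    (by rw [Functor.map_comp, hb', IsIso.hom_inv_id, CategoryTheory.Functor.map_id])
  have h₂ := isIso_quot_map_coneMap_of_eq_id hw
    (by rw [Functor.map_comp, ha', IsIso.inv_hom_id, CategoryTheory.Functor.map_id])
    (by rw [Functor.map_comp, hb', IsIso.inv_hom_id, CategoryTheory.Functor.map_id])
  rw [← hcomp, Functor.map_comp] at h₁
  rw [← hcomp', Functor.map_comp] at h₂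
  exact isIso_of_isIso_comp_comp _ (DGHot.quot.map (coneMap ht))

theorem nonempty_iso_quot_cone {φ : X ⟶ Y} {φ' : X' ⟶ Y'}
    (a : DGHot.quot.obj X ≅ DGHot.quot.obj X') (b : DGHot.quot.obj Y ≅ DGHot.quot.obj Y')
    (h : DGHot.quot.map φ ≫ b.hom = a.hom ≫ DGHot.quot.map φ') :
    Nonempty (DGHot.quot.obj (cone φ) ≅ DGHot.quot.obj (cone φ')) := by
  obtain ⟨a₁, ha₁⟩ := DGHot.quot.map_surjective a.hom
  obtain ⟨b₁, hb₁⟩ := DGHot.quot.map_surjective b.hom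
  obtain ⟨s, hs⟩ := quot_map_eq_iff.1
    (show DGHot.quot.map (φ ≫ b₁) = DGHot.quot.map (a₁ ≫ φ') by
      rw [Functor.map_comp, Functor.map_comp, ha₁, hb₁, h])
  have : IsIso (DGHot.quot.map a₁) := ha₁ ▸ inferInstance
  have : IsIso (DGHot.quot.map b₁) := hb₁ ▸ inferInstance
  have := isIso_quot_map_coneMap hs
  exact ⟨asIso (DGHot.quot.map (coneMap hs))⟩

theorem exists_iso_quot_cone_of_iso (φ : X ⟶ Y) (a : DGHot.quot.obj X ≅ DGHot.quot.obj X')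
    (b : DGHot.quot.obj Y ≅ DGHot.quot.obj Y') :
    ∃ φ' : X' ⟶ Y', Nonempty (DGHot.quot.obj (cone φ) ≅ DGHot.quot.obj (cone φ')) := by
  obtain ⟨φ', hφ'⟩ := DGHot.quot.map_surjective (a.inv ≫ DGHot.quot.map φ ≫ b.hom)
  exact ⟨φ', nonempty_iso_quot_cone a b (by rw [hφ', Iso.hom_inv_id_assoc])⟩

end Cone

end DGModule

namespace DGModule

variable {k : Type u} [CommRing k] {A : Type v} [Ring A] [Algebra k A] {𝒜 : DGAlgebra k A}
  {S T X Y : DGModule 𝒜}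

theorem shift_one_d_apply (M : DGModule 𝒜) (m : M) : (shift 1 M).d m = -M.d m := by
  change (((1 : ℤ).negOnePow : ℤˣ) : ℤ) • M.d m = -M.d m
  rw [Int.negOnePow_one, Units.val_neg, Units.val_one, neg_one_zsmul]

theorem nonempty_iso_cone_of_subsingleton [Subsingleton X] (φ : X ⟶ Y) :
    Nonempty (Y ≅ cone φ) := by
  have : IsIso (coneInl φ) := isIso_of_bijective _
    ⟨LinearMap.inl_injective, fun ⟨y, _⟩ => ⟨y, Prod.ext rfl (Subsingleton.elim _ _)⟩⟩
  exact ⟨asIso (coneInl φ)⟩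

theorem lin_cone_mk {χ : T ⟶ X} (φ : cone χ ⟶ Y) (x : X) (t : T) :
    lin φ ((x, t) : X × T) = lin φ (lin (coneInl χ) x) + lin φ ((0, t) : X × T) :=
  (congrArg (lin φ) (Prod.ext (add_zero x).symm (zero_add t).symm)).trans (map_add (lin φ) _ _)

/-- The connecting morphism `{1}T → C(X → Y)`, `t ↦ (φ(0, t), -χ t)`, of the octahedron on
`X → C(χ) → Y`; its mapping cone is `C(φ)`. -/
def octahedronHom (χ : T ⟶ X) (φ : cone χ ⟶ Y) : shift 1 T ⟶ cone (coneInl χ ≫ φ) where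
  toLin := LinearMap.prod ((lin φ).comp (LinearMap.inr Aᵐᵒᵖ X T)) (-lin χ)
  map_gr i t ht :=
    ⟨lin_mem φ (i := i) ⟨zero_mem _, ht⟩, (X.gr _).neg_mem (lin_mem χ ht)⟩
  map_d t := by
    have hφ : lin φ ((X.d 0 + lin χ t, -T.d t) : X × T) = Y.d (lin φ ((0, t) : X × T)) :=
      lin_d φ ((0, t) : X × T)
    rw [map_zero, zero_add, lin_cone_mk] at hφ
    refine (congrArg _ (shift_one_d_apply T t)).trans (Prod.ext ?_ ?_)
    · change lin φ ((0, -T.d t) : X × T) =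
        Y.d (lin φ ((0, t) : X × T)) + lin φ (lin (coneInl χ) (-lin χ t))
      rw [map_neg, map_neg, ← hφ, add_neg_cancel_comm]
    · change -lin χ (-T.d t) = -X.d (-lin χ t)
      rw [map_neg, map_neg]
      exact congrArg (fun x => - -x) (lin_d χ t)

theorem nonempty_iso_cone_octahedronHom (χ : T ⟶ X) (φ : cone χ ⟶ Y) :
    Nonempty (cone φ ≅ cone (octahedronHom χ φ)) := by
  refine nonempty_iso_of_linearEquiv (M := cone φ) (N := cone (octahedronHom χ φ))
    (LinearEquiv.prodAssoc Aᵐᵒᵖ Y X T).symm (fun i m hm => ⟨⟨hm.1, hm.2.1⟩, hm.2.2⟩) ?_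
  rintro ⟨y, x, t⟩
  refine Prod.ext (Prod.ext ?_ ?_) ?_
  · change Y.d y + lin φ ((x, t) : X × T) =
      Y.d y + lin φ (lin (coneInl χ) x) + lin φ ((0, t) : X × T)
    rw [lin_cone_mk, add_assoc]
  · change -(X.d x + lin χ t) = -X.d x + -lin χ t
    rw [neg_add]
  · exact congrArg Neg.neg (shift_one_d_apply T t).symm

theorem exists_eq_comp_coneInl {χ : T ⟶ X} (φ : S ⟶ cone χ)
    (h : φ ≫ coneSnd χ = zeroHom S (shift 1 T)) : ∃ φ' : S ⟶ X, φ = φ' ≫ coneInl χ := by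
  have hsnd (s : S) : (lin φ s : X × T).2 = 0 := congrArg (fun f => lin f s) h
  let φ' : S ⟶ X :=
    { toLin := (LinearMap.fst Aᵐᵒᵖ X T).comp (lin φ)
      map_gr := fun i s hs => (lin_mem φ hs).1
      map_d := fun s => by
        refine (congrArg Prod.fst (lin_d φ s)).trans ?_
        change X.d (lin φ s : X × T).1 + lin χ (lin φ s : X × T).2 = X.d (lin φ s : X × T).1
        rw [hsnd, map_zero, add_zero] }
  exact ⟨φ', ext_apply fun s => Prod.ext rfl (hsnd s)⟩

theorem nonempty_iso_cone_swap (χ : T ⟶ X) (φ : S ⟶ X) :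
    Nonempty (cone (φ ≫ coneInl χ) ≅ cone (χ ≫ coneInl φ)) := by
  let e : ((X × T) × S) ≃ₗ[Aᵐᵒᵖ] ((X × S) × T) :=
    LinearEquiv.prodAssoc Aᵐᵒᵖ X T S ≪≫ₗ
      (LinearEquiv.refl Aᵐᵒᵖ X).prodCongr (LinearEquiv.prodComm Aᵐᵒᵖ T S) ≪≫ₗ
      (LinearEquiv.prodAssoc Aᵐᵒᵖ X S T).symm
  refine nonempty_iso_of_linearEquiv (M := cone (φ ≫ coneInl χ)) (N := cone (χ ≫ coneInl φ)) e
    (fun i m hm => ⟨⟨hm.1.1, hm.2⟩, hm.1.2⟩) ?_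
  rintro ⟨⟨x, t⟩, s⟩
  change (((X.d x + lin χ t + lin φ s, -S.d s), -T.d t + 0) : (X × S) × T) =
    ((X.d x + lin φ s + lin χ t, -S.d s + 0), -T.d t)
  rw [add_right_comm, add_zero, add_zero]

section Cancellation

variable {χ : T ⟶ X} {φ : shift 1 T ⟶ cone χ}

theorem exists_isHomotopy_of_section (h : φ ≫ coneSnd χ = 𝟙 (shift 1 T)) :
    ∃ s : T →ₗ[Aᵐᵒᵖ] X, IsHomotopy (χ ≫ 𝟙 X) (zeroHom T X) s ∧
      ∀ t : T, lin φ t = ((-s t, t) : X × T) := by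
  let f : T →ₗ[Aᵐᵒᵖ] X := (LinearMap.fst Aᵐᵒᵖ X T).comp (lin φ)
  have hφ (t : T) : lin φ t = ((f t, t) : X × T) :=
    Prod.ext rfl (congrArg (fun g : shift 1 T ⟶ shift 1 T => lin g t) h)
  have hd (t : T) : f (-T.d t) = X.d (f t) + lin χ t := by
    have hφd := congrArg (Prod.fst : X × T → X) (lin_d φ t)
    rw [shift_one_d_apply, hφ t] at hφd
    exact hφd
  refine ⟨-f, ⟨fun i t ht => (X.gr _).neg_mem (lin_mem φ (i := i - 1) (m := t) ?_).1, fun t => ?_⟩,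
    fun t => (hφ t).trans (Prod.ext (neg_neg (f t)).symm rfl)⟩
  · change t ∈ T.gr (i - 1 + 1)
    rwa [sub_add_cancel]
  · have hdt := hd t
    rw [map_neg] at hdt
    change lin χ t - 0 = X.d (-f t) + -f (T.d t)
    rw [sub_zero, map_neg, hdt, neg_add_cancel_left]

theorem isHomotopy_coneDesc_comp_id {s : T →ₗ[Aᵐᵒᵖ] X}
    (hs : IsHomotopy (χ ≫ 𝟙 X) (zeroHom T X) s) (hφ : ∀ t : T, lin φ t = ((-s t, t) : X × T))
    (hφs : IsHomotopy (φ ≫ coneDesc χ (𝟙 X) s hs) (zeroHom (shift 1 T) X) 0) :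
    IsHomotopy (coneDesc φ (coneDesc χ (𝟙 X) s hs) 0 hφs ≫ coneInl χ ≫ coneInl φ) (𝟙 (cone φ))
      (-(LinearMap.inr Aᵐᵒᵖ (X × T) T).comp
        ((LinearMap.snd Aᵐᵒᵖ X T).comp (LinearMap.fst Aᵐᵒᵖ (X × T) T))) where
  mem i m hm := ((cone φ).gr _).neg_mem ⟨zero_mem _, by
    change m.1.2 ∈ T.gr (i - 1 + 1 + 1)
    rw [sub_add_cancel]
    exact hm.1.2⟩
  sub_eq := by
    rintro ⟨⟨x, t⟩, (u : T)⟩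
    have hd : (cone φ).d (((0, 0), t) : (X × T) × T) = (((-s t, t), T.d t) : (X × T) × T) :=
      Prod.ext ((congrArg₂ (· + ·) (map_zero (cone χ).d) (hφ t)).trans (zero_add _))
        (neg_eq_iff_eq_neg.2 (shift_one_d_apply T t))
    refine Eq.trans ?_ (congrArg (· + _) ((map_neg (cone φ).d _).trans (congrArg Neg.neg hd)).symm)
    refine Prod.ext (Prod.ext ?_ ?_) ?_
    · change x + s t + 0 - x = - -s t + -0
      rw [add_zero, add_sub_cancel_left, neg_neg, neg_zero, add_zero]
    · change 0 - t = -t + -0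
      rw [zero_sub, neg_zero, add_zero]
    · change 0 - u = -T.d t + -(-T.d t + (lin φ u : X × T).2)
      have hu : (lin φ u : X × T).2 = u := congrArg Prod.snd (hφ u)
      rw [hu, zero_sub, neg_add, neg_neg, neg_add_cancel_left]

theorem nonempty_iso_quot_cone_of_section (h : φ ≫ coneSnd χ = 𝟙 (shift 1 T)) :
    Nonempty (DGHot.quot.obj (cone φ) ≅ DGHot.quot.obj X) := by
  obtain ⟨s, hs, hφ⟩ := exists_isHomotopy_of_section h
  have hφs : IsHomotopy (φ ≫ coneDesc χ (𝟙 X) s hs) (zeroHom (shift 1 T) X) 0 :=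
    { mem := fun _ _ _ => zero_mem _
      sub_eq := fun t => by
        refine (congrArg (lin (coneDesc χ (𝟙 X) s hs) · - 0) (hφ t)).trans ?_
        change -s t + s t - 0 = X.d 0 + 0
        rw [neg_add_cancel, sub_zero, map_zero, add_zero] }
  let r : cone φ ⟶ X := coneDesc φ (coneDesc χ (𝟙 X) s hs) 0 hφs
  let i : X ⟶ cone φ := coneInl χ ≫ coneInl φ
  have hir : i ≫ r = 𝟙 X := ext_apply fun x => by
    change x + s 0 + 0 = x
    rw [map_zero, add_zero, add_zero]
  have hri : DGHot.quot.map (r ≫ i) = DGHot.quot.map (𝟙 (cone φ)) :=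
    quot_map_eq_iff.2 ⟨_, isHomotopy_coneDesc_comp_id hs hφ hφs⟩
  exact ⟨⟨DGHot.quot.map r, DGHot.quot.map i,
    by rw [← Functor.map_comp, hri, CategoryTheory.Functor.map_id],
    by rw [← Functor.map_comp, hir, CategoryTheory.Functor.map_id]⟩⟩

end Cancellation

theorem nonempty_iso_quot_cone_of_isIso {χ : T ⟶ X} (φ : S ⟶ cone χ) [IsIso (φ ≫ coneSnd χ)] :
    Nonempty (DGHot.quot.obj (cone φ) ≅ DGHot.quot.obj X) := by
  let e : S ≅ shift 1 T := asIso (φ ≫ coneSnd χ)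
  obtain ⟨f⟩ := nonempty_iso_cone (φ' := e.inv ≫ φ) e (Iso.refl (cone χ))
    (by rw [Iso.refl_hom, Category.comp_id, Iso.hom_inv_id_assoc])
  obtain ⟨g⟩ := nonempty_iso_quot_cone_of_section (φ := e.inv ≫ φ)
    (by rw [Category.assoc]; exact e.inv_hom_id)
  exact ⟨DGHot.quot.mapIso f ≪≫ g⟩

theorem exists_iso_shift_cone (n : ℤ) (φ : X ⟶ Y) :
    ∃ ψ : shift n X ⟶ shift n Y, Nonempty (shift n (cone φ) ≅ cone ψ) := by
  have hd (x : X) : ((n.negOnePow : ℤˣ) : ℤ) • lin φ (((n.negOnePow : ℤˣ) : ℤ) • X.d x) =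
      ((n.negOnePow : ℤˣ) : ℤ) • Y.d (((n.negOnePow : ℤˣ) : ℤ) • lin φ x) := by
    rw [map_zsmul, map_zsmul, lin_d]
  let ψ : shift n X ⟶ shift n Y :=
    { toLin := (((n.negOnePow : ℤˣ) : ℤ) • lin φ : X →ₗ[Aᵐᵒᵖ] Y)
      map_gr := fun i x hx => (Y.gr _).zsmul_mem (lin_mem φ hx) _
      map_d := hd }
  refine ⟨ψ, nonempty_iso_of_linearEquiv (M := shift n (cone φ)) (N := cone ψ)
    (LinearEquiv.refl Aᵐᵒᵖ (Y × X)) (fun i m hm => ⟨hm.1, ?_⟩) ?_⟩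
  · change m.2 ∈ X.gr (i + 1 + n)
    rw [add_right_comm]
    exact hm.2
  · rintro ⟨y, x⟩
    change ((n.negOnePow : ℤˣ) : ℤ) • ((Y.d y + lin φ x, -X.d x) : Y × X) =
      (((n.negOnePow : ℤˣ) : ℤ) • Y.d y + ((n.negOnePow : ℤˣ) : ℤ) • lin φ x,
        -(((n.negOnePow : ℤˣ) : ℤ) • X.d x))
    rw [Prod.smul_mk, smul_add, smul_neg]

end DGModule

theorem bijective_coprod_of_exact {R N M Q : Type*} [Ring R] [AddCommGroup N] [AddCommGroup M]
    [AddCommGroup Q] [Module R N] [Module R M] [Module R Q] {f : N →ₗ[R] M} {p : M →ₗ[R] Q}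
    {σ : Q →ₗ[R] M} (hf : Function.Injective f) (hfp : Function.Exact f p)
    (hσ : ∀ t, p (σ t) = t) : Function.Bijective (f.coprod σ) := by
  constructor
  · refine (injective_iff_map_eq_zero _).2 fun ⟨n, t⟩ h => ?_
    change f n + σ t = 0 at h
    have ht : t = 0 := by
      simpa only [map_add, hfp.apply_apply_eq_zero, hσ, zero_add, map_zero] using congrArg p h
    rw [ht, map_zero, add_zero] at h
    exact Prod.ext (hf (h.trans (map_zero f).symm)) ht
  · intro m
    obtain ⟨n, hn⟩ := (hfp (m - σ (p m))).1 (by rw [map_sub, hσ, sub_self])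
    exact ⟨(n, p m), by rw [LinearMap.coprod_apply, hn, sub_add_cancel]⟩

namespace DGModule

variable {k : Type u} [CommRing k] {A : Type v} [Ring A] [Algebra k A] {𝒜 : DGAlgebra k A}
  {N M M' Q T : DGModule 𝒜}

/-- `0 → N → M → Q → 0` is a short exact sequence of dg modules. -/
structure IsShortExact (f : N ⟶ M) (p : M ⟶ Q) : Prop where
  injective : Function.Injective (lin f)
  surjective : Function.Surjective (lin p)
  exact : Function.Exact (lin f) (lin p)

theorem isShortExact_cone (χ : T ⟶ N) : IsShortExact (coneInl χ) (coneSnd χ) where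
  injective := LinearMap.inl_injective
  surjective := Prod.snd_surjective (α := N)
  exact := Function.Exact.inl_snd (M := N) (N := T)

theorem IsShortExact.of_iso {f : N ⟶ M} {p : M ⟶ Q} (h : IsShortExact f p) (e : M' ≅ M) :
    IsShortExact (f ≫ e.inv) (e.hom ≫ p) where
  injective := (lin_bijective e.inv).1.comp h.injective
  surjective := h.surjective.comp (lin_bijective e.hom).2
  exact m := by
    rw [lin_comp, h.exact]
    refine exists_congr fun n => ?_
    rw [lin_comp]
    refine ⟨fun hn => ?_, fun hn => ?_⟩
    · rw [hn, ← lin_comp, e.hom_inv_id, lin_id]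
    · rw [← hn, ← lin_comp, e.inv_hom_id, lin_id]

theorem isShortExact_zeroHom_id [Subsingleton N] : IsShortExact (zeroHom N M) (𝟙 M) where
  injective := Function.injective_of_subsingleton _
  surjective := Function.surjective_id
  exact _ := ⟨fun hm => ⟨0, hm.symm⟩, fun ⟨_, hn⟩ => hn.symm⟩

theorem d_sub_map_d_smul {σ : Q →ₗ[Aᵐᵒᵖ] M} (hσ : ∀ i, ∀ t ∈ Q.gr i, σ t ∈ M.gr i) (a : Aᵐᵒᵖ)
    (t : Q) : M.d (σ (a • t)) - σ (Q.d (a • t)) = a • (M.d (σ t) - σ (Q.d t)) := by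
  induction t using gr_induction with
  | zero => simp only [smul_zero, map_zero, sub_zero]
  | add x y hx hy =>
    simp only [smul_add, map_add] at hx hy ⊢
    rw [add_sub_add_comm, hx, hy, ← smul_add, ← add_sub_add_comm]
  | mem i t ht =>
    have hQ := Q.leibniz i t ht a.unop
    have hM := M.leibniz i (σ t) (hσ i t ht) a.unop
    rw [MulOpposite.op_unop] at hQ hM
    rw [map_smul, hQ, hM, map_add, map_zsmul, map_smul, map_smul, add_sub_add_right_eq_sub,
      smul_sub]

/-- The graded commutator `dσ - σd` of an `A`-linear map `σ` of degree zero with the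
differentials. -/
def commutator (σ : Q →ₗ[Aᵐᵒᵖ] M) (hσ : ∀ i, ∀ t ∈ Q.gr i, σ t ∈ M.gr i) : Q →ₗ[Aᵐᵒᵖ] M where
  toFun t := M.d (σ t) - σ (Q.d t)
  map_add' x y := by rw [map_add, map_add, map_add, map_add, add_sub_add_comm]
  map_smul' a t := d_sub_map_d_smul hσ a t

theorem commutator_apply {σ : Q →ₗ[Aᵐᵒᵖ] M} (hσ : ∀ i, ∀ t ∈ Q.gr i, σ t ∈ M.gr i) (t : Q) :
    commutator σ hσ t = M.d (σ t) - σ (Q.d t) := rfl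

theorem exists_lin_eq_commutator {f : N ⟶ M} {p : M ⟶ Q} (h : IsShortExact f p)
    {σ : Q →ₗ[Aᵐᵒᵖ] M} (hσgr : ∀ i, ∀ t ∈ Q.gr i, σ t ∈ M.gr i) (hσ : ∀ t, lin p (σ t) = t) :
    ∃ χ : shift (-1) Q ⟶ N, ∀ t : Q, lin f (lin χ t) = commutator σ hσgr t := by
  have hrange (t : Q) : commutator σ hσgr t ∈ LinearMap.range (lin f) := by
    refine (h.exact _).1 ?_
    rw [commutator_apply, map_sub, hσ, lin_d, hσ, sub_self]
  let e := LinearEquiv.ofInjective (lin f) h.injective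
  let χ₀ : Q →ₗ[Aᵐᵒᵖ] N := e.symm.toLinearMap.comp ((commutator σ hσgr).codRestrict _ hrange)
  have hχ₀ (t : Q) : lin f (χ₀ t) = commutator σ hσgr t :=
    congrArg Subtype.val (e.apply_symm_apply ⟨commutator σ hσgr t, hrange t⟩)
  have hχ₀d (t : Q) : χ₀ ((((-1 : ℤ).negOnePow : ℤˣ) : ℤ) • Q.d t) = N.d (χ₀ t) := h.injective (by
    rw [lin_d, Int.negOnePow_neg, Int.negOnePow_one, Units.val_neg, Units.val_one, neg_one_zsmul,
      map_neg, map_neg, hχ₀, hχ₀, commutator_apply, commutator_apply, map_sub, M.d_d, Q.d_d,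
      map_zero, sub_zero, zero_sub])
  have hχ₀gr (i : ℤ) (t : Q) (ht : t ∈ Q.gr (i + -1)) : χ₀ t ∈ N.gr i := by
    refine mem_gr_of_lin_mem h.injective ?_
    rw [hχ₀, commutator_apply, ← neg_add_cancel_right i 1]
    exact sub_mem (M.d_mem _ _ (hσgr _ _ ht)) (hσgr _ _ (Q.d_mem _ _ ht))
  exact ⟨{ toLin := χ₀, map_gr := hχ₀gr, map_d := hχ₀d }, hχ₀⟩

theorem IsShortExact.exists_iso_cone_of_section {f : N ⟶ M} {p : M ⟶ Q} (h : IsShortExact f p)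
    {σ : Q →ₗ[Aᵐᵒᵖ] M} (hσgr : ∀ i, ∀ t ∈ Q.gr i, σ t ∈ M.gr i) (hσ : ∀ t, lin p (σ t) = t) :
    ∃ χ : shift (-1) Q ⟶ N, Nonempty (M ≅ cone χ) := by
  obtain ⟨χ, hχ⟩ := exists_lin_eq_commutator h hσgr hσ
  have hsub (t : Q) :
      lin f (lin χ t) - 0 = M.d (σ t) + σ ((((-1 : ℤ).negOnePow : ℤˣ) : ℤ) • Q.d t) := by
    rw [sub_zero, hχ, commutator_apply, Int.negOnePow_neg, Int.negOnePow_one,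
      Units.val_neg, Units.val_one, neg_one_zsmul, map_neg, sub_eq_add_neg]
  have hs : IsHomotopy (χ ≫ f) (zeroHom (shift (-1) Q) M) σ :=
    { mem := fun i t ht => hσgr _ t ht
      sub_eq := hsub }
  have := isIso_of_bijective (coneDesc χ f σ hs) (bijective_coprod_of_exact h.injective h.exact hσ)
  exact ⟨χ, ⟨(asIso (coneDesc χ f σ hs)).symm⟩⟩

end DGModule

section DegZero

variable {k : Type u} [CommRing k] {A : Type v} [Ring A] [Algebra k A] {𝒜 : DGAlgebra k A}

/-- The inclusion of the ring `A^0` into `A`. -/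
def DGAlgebra.degZeroHom (𝒜 : DGAlgebra k A) : 𝒜.degZero →+* A where
  toFun := Subtype.val
  map_one' := rfl
  map_mul' _ _ := rfl
  map_zero' := rfl
  map_add' _ _ := rfl

namespace DGModule

/-- The right `A^0`-module underlying a dg module. -/
instance degZeroModule (M : DGModule 𝒜) : Module 𝒜.degZeroᵐᵒᵖ M :=
  Module.compHom M (RingHom.op 𝒜.degZeroHom)

theorem degZero_smul {M : DGModule 𝒜} (b : 𝒜.degZeroᵐᵒᵖ) (m : M) :
    b • m = MulOpposite.op (b.unop : A) • m := rfl

instance (M N : DGModule 𝒜) : LinearMap.CompatibleSMul M N 𝒜.degZeroᵐᵒᵖ Aᵐᵒᵖ :=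
  ⟨fun f _ m => map_smul f _ m⟩

theorem degZero_smul_mem {M : DGModule 𝒜} {i : ℤ} {m : M} (hm : m ∈ M.gr i)
    (b : 𝒜.degZeroᵐᵒᵖ) : b • m ∈ M.gr i := by
  rw [degZero_smul, ← add_zero i]
  exact M.smul_mem i 0 m hm _ b.unop.2

/-- The projection of a dg module to its component of degree `i`, as an `A^0`-linear map. -/
noncomputable def degZeroProj (M : DGModule 𝒜) (i : ℤ) : M →ₗ[𝒜.degZeroᵐᵒᵖ] M where
  toFun := M.proj i
  map_add' := map_add _
  map_smul' b m :=
    (map_proj (DistribSMul.toAddMonoidHom M b) (fun _ _ hm => degZero_smul_mem hm b) i m).symm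

end DGModule

end DegZero

section Hat

open TensorProduct DGModule

namespace DGAlgebra

variable {k : Type u} [CommRing k] {A : Type v} [Ring A] [Algebra k A] {𝒜 : DGAlgebra k A}
  {L L' : Type v} [AddCommGroup L] [Module 𝒜.degZeroᵐᵒᵖ L] [AddCommGroup L']
  [Module 𝒜.degZeroᵐᵒᵖ L'] (h : ∀ a ∈ 𝒜.gr 0, 𝒜.d a = 0)

/-- The map `L → L ⊗_{A^0} A`, `l ↦ l ⊗ 1`. An element `l ⊗ a` of `L ⊗_{A^0} A` is written as
`MulOpposite.op a • hatι h l`. -/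
def hatι : L →ₗ[𝒜.degZeroᵐᵒᵖ] 𝒜.hat L h where
  toFun l := (balancedRel 𝒜 L).mkQ (1 ⊗ₜ[ℤ] l)
  map_add' l l' :=
    (congrArg _ (tmul_add 1 l l')).trans (map_add (balancedRel 𝒜 L).mkQ _ _)
  map_smul' b l := by
    refine (Submodule.Quotient.eq _).2 (Submodule.subset_span ⟨l, b.unop, 1, ?_⟩)
    change 1 ⊗ₜ[ℤ] (b • l) - MulOpposite.op (b.unop : A) • (1 : A) ⊗ₜ[ℤ] l =
      1 ⊗ₜ[ℤ] (b • l) - ((b.unop : A) * 1) ⊗ₜ[ℤ] l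
    rw [smul_tmul', op_smul_eq_mul, one_mul, mul_one]

theorem mkQ_tmul_eq_smul_hatι (a : A) (l : L) :
    (balancedRel 𝒜 L).mkQ (a ⊗ₜ[ℤ] l) = MulOpposite.op a • hatι h l := by
  change _ = (balancedRel 𝒜 L).mkQ (MulOpposite.op a • 1 ⊗ₜ[ℤ] l)
  rw [smul_tmul', op_smul_eq_mul, one_mul]

theorem hatι_mem (l : L) : hatι h l ∈ (𝒜.hat L h).gr 0 :=
  AddSubgroup.subset_closure ⟨1, SetLike.one_mem_graded 𝒜.gr, l, rfl⟩

theorem hat_gr_le {i : ℤ} {S : AddSubgroup (𝒜.hat L h)}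
    (hS : ∀ l, ∀ a ∈ 𝒜.gr i, MulOpposite.op a • hatι h l ∈ S) : (𝒜.hat L h).gr i ≤ S := by
  refine (AddSubgroup.closure_le S).2 ?_
  rintro _ ⟨a, ha, l, rfl⟩
  rw [mkQ_tmul_eq_smul_hatι h]
  exact hS l a ha

theorem hat_linearMap_ext {M : DGModule 𝒜} {f g : 𝒜.hat L h →ₗ[Aᵐᵒᵖ] M}
    (hfg : ∀ l : L, f (hatι h l) = g (hatι h l)) : f = g := by
  refine Submodule.linearMap_qext _ (TensorProduct.AlgebraTensorModule.ext fun a l => ?_)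
  change f ((balancedRel 𝒜 L).mkQ (a ⊗ₜ[ℤ] l)) = g ((balancedRel 𝒜 L).mkQ (a ⊗ₜ[ℤ] l))
  rw [mkQ_tmul_eq_smul_hatι h, map_smul, map_smul, hfg]

/-- The `A`-linear map `L ⊗_{A^0} A → M` induced by an `A^0`-linear map `L → M`. -/
def hatLift {M : DGModule 𝒜} (g : L →ₗ[𝒜.degZeroᵐᵒᵖ] M) : 𝒜.hat L h →ₗ[Aᵐᵒᵖ] M :=
  (balancedRel 𝒜 L).liftQ
    (AlgebraTensorModule.lift
      { toFun := fun a => MulOpposite.op a • g.toAddMonoidHom.toIntLinearMap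
        map_add' := fun a b => by rw [MulOpposite.op_add, add_smul]
        map_smul' := fun c a => by
          rw [MulOpposite.smul_eq_mul_unop, MulOpposite.op_mul, MulOpposite.op_unop, mul_smul,
            RingHom.id_apply] })
    (Submodule.span_le.2 (by
      rintro _ ⟨l, b, a, rfl⟩
      refine LinearMap.mem_ker.2 ((map_sub _ _ _).trans (sub_eq_zero_of_eq ?_))
      change MulOpposite.op a • g (MulOpposite.op b • l) = MulOpposite.op (b * a) • g l
      rw [map_smul, degZero_smul, smul_smul, MulOpposite.op_mul, MulOpposite.unop_op]))

theorem hatLift_hatι {M : DGModule 𝒜} (g : L →ₗ[𝒜.degZeroᵐᵒᵖ] M) (l : L) :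
    hatLift h g (hatι h l) = g l :=
  one_smul Aᵐᵒᵖ (g l)

theorem hatLift_mem {M : DGModule 𝒜} {g : L →ₗ[𝒜.degZeroᵐᵒᵖ] M} {n : ℤ}
    (hg : ∀ l, g l ∈ M.gr n) {i : ℤ} {x : 𝒜.hat L h} (hx : x ∈ (𝒜.hat L h).gr i) :
    hatLift h g x ∈ M.gr (n + i) := by
  refine hat_gr_le h (S := (M.gr (n + i)).comap (hatLift h g).toAddMonoidHom) (fun l a ha => ?_) hx
  change hatLift h g (MulOpposite.op a • hatι h l) ∈ M.gr (n + i)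
  rw [map_smul, hatLift_hatι]
  exact M.smul_mem _ _ _ (hg l) _ ha

theorem mem_range_hatι {x : 𝒜.hat L h} (hx : x ∈ (𝒜.hat L h).gr 0) :
    x ∈ LinearMap.range (hatι (L := L) h) :=
  hat_gr_le h (S := (LinearMap.range (hatι (L := L) h)).toAddSubgroup)
    (fun l a ha => ⟨MulOpposite.op (⟨a, ha⟩ : 𝒜.degZero) • l, map_smul (hatι h) _ l⟩) hx

theorem eq_zero_of_mem_hat_gr {i : ℤ} (hi : 𝒜.gr i = ⊥) {x : 𝒜.hat L h}
    (hx : x ∈ (𝒜.hat L h).gr i) : x = 0 := by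
  refine AddSubgroup.mem_bot.1 (hat_gr_le h (fun l a ha => ?_) hx)
  rw [hi, Submodule.mem_bot] at ha
  rw [ha, MulOpposite.op_zero, zero_smul]
  exact zero_mem _

theorem hatι_mem_shift (n : ℤ) (l : L) : hatι h l ∈ (shift n (𝒜.hat L h)).gr (-n) := by
  change hatι h l ∈ (𝒜.hat L h).gr (-n + n)
  rw [neg_add_cancel]
  exact hatι_mem h l

theorem bijective_of_map_hatι {f : 𝒜.hat L h →ₗ[Aᵐᵒᵖ] 𝒜.hat L' h} (e : L ≃ₗ[𝒜.degZeroᵐᵒᵖ] L')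
    (hf : ∀ l, f (hatι h l) = hatι h (e l)) : Function.Bijective f := by
  let f' : 𝒜.hat L' h →ₗ[Aᵐᵒᵖ] 𝒜.hat L h := hatLift h ((hatι h).comp e.symm.toLinearMap)
  have hf' (l : L') : f' (hatι h l) = hatι h (e.symm l) := hatLift_hatι h _ l
  have hleft : f' ∘ₗ f = LinearMap.id := hat_linearMap_ext h fun l => by
    rw [LinearMap.comp_apply, hf, hf', e.symm_apply_apply, LinearMap.id_apply]
  have hright : f ∘ₗ f' = LinearMap.id := hat_linearMap_ext h fun l => by
    rw [LinearMap.comp_apply, hf', hf, e.apply_symm_apply, LinearMap.id_apply]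
  exact Function.bijective_iff_has_inverse.2
    ⟨f', LinearMap.congr_fun hleft, LinearMap.congr_fun hright⟩

theorem exists_linearMap_hatι [Module.Projective 𝒜.degZeroᵐᵒᵖ L]
    {f : 𝒜.hat L h →ₗ[Aᵐᵒᵖ] 𝒜.hat L' h} (hf : ∀ l, f (hatι h l) ∈ (𝒜.hat L' h).gr 0) :
    ∃ g : L →ₗ[𝒜.degZeroᵐᵒᵖ] L', ∀ l, f (hatι h l) = hatι h (g l) := by
  obtain ⟨g, hg⟩ := Module.projective_lifting_property (hatι (L := L') h).rangeRestrict
    (((f.restrictScalars 𝒜.degZeroᵐᵒᵖ).comp (hatι h)).codRestrict _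
      fun l => mem_range_hatι h (hf l))
    (LinearMap.surjective_rangeRestrict _)
  exact ⟨g, fun l => (congrArg Subtype.val (LinearMap.congr_fun hg l)).symm⟩

theorem hat_eq_zero_or_bijective [IsSimpleModule 𝒜.degZeroᵐᵒᵖ L]
    [IsSimpleModule 𝒜.degZeroᵐᵒᵖ L'] [Module.Projective 𝒜.degZeroᵐᵒᵖ L]
    {f : 𝒜.hat L h →ₗ[Aᵐᵒᵖ] 𝒜.hat L' h} (hf : ∀ l, f (hatι h l) ∈ (𝒜.hat L' h).gr 0) :
    f = 0 ∨ Function.Bijective f := by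
  obtain ⟨g, hg⟩ := exists_linearMap_hatι h hf
  rcases LinearMap.bijective_or_eq_zero g with hbij | rfl
  · exact Or.inr (bijective_of_map_hatι h (LinearEquiv.ofBijective g hbij) hg)
  · exact Or.inl (hat_linearMap_ext h fun l => (hg l).trans (map_zero (hatι h)))

theorem eq_zeroHom_or_isIso_of_le [IsSimpleModule 𝒜.degZeroᵐᵒᵖ L]
    [IsSimpleModule 𝒜.degZeroᵐᵒᵖ L'] [Module.Projective 𝒜.degZeroᵐᵒᵖ L]
    (hneg : ∀ i < 0, 𝒜.gr i = ⊥) {p q : ℤ} (hpq : q ≤ p)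
    (ψ : shift p (𝒜.hat L h) ⟶ shift q (𝒜.hat L' h)) :
    ψ = zeroHom _ _ ∨ IsIso ψ := by
  let f : 𝒜.hat L h →ₗ[Aᵐᵒᵖ] 𝒜.hat L' h := ψ.toLin
  have hf (l : L) : f (hatι h l) ∈ (𝒜.hat L' h).gr (-p + q) := lin_mem ψ (hatι_mem_shift h p l)
  rcases hpq.lt_or_eq with hlt | rfl
  · have hzero : f = 0 :=
      hat_linearMap_ext h fun l => eq_zero_of_mem_hat_gr h (hneg _ (by lia)) (hf l)
    exact Or.inl (hom_ext hzero)
  · rw [neg_add_cancel] at hf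
    exact (hat_eq_zero_or_bijective h hf).imp hom_ext (isIso_of_bijective ψ)

end DGAlgebra

namespace DGModule

open DGAlgebra

variable {k : Type u} [CommRing k] {A : Type v} [Ring A] [Algebra k A] {𝒜 : DGAlgebra k A}
  {L : Type v} [AddCommGroup L] [Module 𝒜.degZeroᵐᵒᵖ L] [Module.Projective 𝒜.degZeroᵐᵒᵖ L]
  {h : ∀ a ∈ 𝒜.gr 0, 𝒜.d a = 0} {n : ℤ} {N M Q : DGModule 𝒜}

theorem exists_section_of_surjective_shift_hat {p : M ⟶ shift n (𝒜.hat L h)}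
    (hp : Function.Surjective (lin p)) :
    ∃ σ : shift n (𝒜.hat L h) →ₗ[Aᵐᵒᵖ] M,
      (∀ i, ∀ t ∈ (shift n (𝒜.hat L h)).gr i, σ t ∈ M.gr i) ∧ ∀ t, lin p (σ t) = t := by
  obtain ⟨g, hg⟩ := Module.projective_lifting_property ((lin p).restrictScalars 𝒜.degZeroᵐᵒᵖ)
    (hatι h) hp
  have hpg (l : L) : lin p (g l) = hatι h l := LinearMap.congr_fun hg l
  let σ : 𝒜.hat L h →ₗ[Aᵐᵒᵖ] M := hatLift h ((M.degZeroProj (-n)).comp g)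
  have hσ (l : L) : σ (hatι h l) = M.proj (-n) (g l) := hatLift_hatι h _ l
  have hpσ : (lin p).comp σ = LinearMap.id (M := 𝒜.hat L h) := hat_linearMap_ext h fun l => by
    rw [LinearMap.comp_apply, hσ, lin_proj, hpg]
    exact proj_of_mem (hatι_mem_shift h n l)
  refine ⟨σ, fun i t ht => ?_, LinearMap.congr_fun hpσ⟩
  rw [← neg_add_cancel_comm_assoc n i]
  exact hatLift_mem h (fun l => M.proj_mem (-n) (g l)) ht

theorem IsShortExact.exists_iso_cone_of_iso_shift_hat {f : N ⟶ M} {p : M ⟶ Q}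
    (hfp : IsShortExact f p) (e : Q ≅ shift n (𝒜.hat L h)) :
    ∃ χ : shift (-1) Q ⟶ N, Nonempty (M ≅ cone χ) := by
  have he : Function.Bijective (lin e.hom) := lin_bijective e.hom
  obtain ⟨σ, hσgr, hσ⟩ := exists_section_of_surjective_shift_hat (p := p ≫ e.hom)
    (he.2.comp hfp.surjective)
  exact hfp.exists_iso_cone_of_section (σ := σ.comp (lin e.hom))
    (fun i t ht => hσgr i _ (lin_mem e.hom ht)) (fun t => he.1 (hσ _))

end DGModule

end Hat

section Subquotient

variable {k : Type u} [CommRing k] {A : Type v} [Ring A] [Algebra k A] {𝒜 : DGAlgebra k A}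
  {M M' Q : DGModule 𝒜}

namespace DGSubmodule

open DGModule

/-- The image of a dg submodule under a morphism of dg modules. -/
def map (f : M ⟶ M') (P : DGSubmodule M) : DGSubmodule M' where
  sub := P.sub.map (lin f)
  proj_mem := by
    rintro i _ ⟨x, hx, rfl⟩
    exact ⟨M.proj i x, P.proj_mem i x hx, lin_proj f i x⟩
  d_mem := by
    rintro _ ⟨x, hx, rfl⟩
    exact ⟨M.d x, P.d_mem x hx, lin_d f x⟩

/-- `M` as a dg submodule of itself. -/
def top (M : DGModule 𝒜) : DGSubmodule M where
  sub := ⊤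
  proj_mem _ _ _ := trivial
  d_mem _ _ := trivial

/-- The morphism `P / N → P' / N'` induced by a morphism of the ambient dg modules. -/
noncomputable def subquotientMap (f : M ⟶ M') {N P : DGSubmodule M} {N' P' : DGSubmodule M'}
    (hN : N.sub ≤ N'.sub.comap (lin f)) (hP : P.sub ≤ P'.sub.comap (lin f)) :
    subquotient N P ⟶ subquotient N' P' where
  toLin := Submodule.mapQ (N.sub.submoduleOf P.sub) (N'.sub.submoduleOf P'.sub)
    ((lin f).restrict hP) fun _ hx => hN hx
  map_gr := by
    rintro i _ ⟨x, hx, rfl⟩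
    exact ⟨(lin f).restrict hP x, lin_mem f hx, rfl⟩
  map_d m := by
    obtain ⟨x, rfl⟩ := (N.sub.submoduleOf P.sub).mkQ_surjective m
    exact congrArg (N'.sub.submoduleOf P'.sub).mkQ (Subtype.ext (lin_d f (x : M)))

section

variable {f : M ⟶ M'} {N P : DGSubmodule M} {N' P' : DGSubmodule M'}
  {hN : N.sub ≤ N'.sub.comap (lin f)} {hP : P.sub ≤ P'.sub.comap (lin f)}

theorem lin_subquotientMap_mkQ_eq_zero_iff (x : P.sub) :
    lin (subquotientMap f hN hP) ((N.sub.submoduleOf P.sub).mkQ x) = 0 ↔ lin f x ∈ N'.sub :=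
  Submodule.Quotient.mk_eq_zero _

theorem subquotientMap_injective (h : ∀ x ∈ P.sub, lin f x ∈ N'.sub → x ∈ N.sub) :
    Function.Injective (lin (subquotientMap f hN hP)) := by
  refine (injective_iff_map_eq_zero _).2 fun m hm => ?_
  obtain ⟨x, rfl⟩ := (N.sub.submoduleOf P.sub).mkQ_surjective m
  exact (Submodule.Quotient.mk_eq_zero _).2
    (h x x.2 ((lin_subquotientMap_mkQ_eq_zero_iff x).1 hm))

theorem subquotientMap_surjective (h : P'.sub ≤ P.sub.map (lin f)) :
    Function.Surjective (lin (subquotientMap f hN hP)) := by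
  intro m
  obtain ⟨⟨y, hy⟩, rfl⟩ := (N'.sub.submoduleOf P'.sub).mkQ_surjective m
  obtain ⟨x, hx, rfl⟩ := h hy
  exact ⟨(N.sub.submoduleOf P.sub).mkQ ⟨x, hx⟩, rfl⟩

end

theorem nonempty_iso_subquotient_map {f : M ⟶ M'} (hf : Function.Injective (lin f))
    (N P : DGSubmodule M) : Nonempty (subquotient N P ≅ subquotient (N.map f) (P.map f)) := by
  let g : subquotient N P ⟶ subquotient (N.map f) (P.map f) :=
    subquotientMap f (Submodule.le_comap_map _ _) (Submodule.le_comap_map _ _)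
  have := isIso_of_bijective g
    ⟨subquotientMap_injective fun _ _ ⟨_, hy, hyx⟩ => hf hyx ▸ hy,
      subquotientMap_surjective le_rfl⟩
  exact ⟨asIso g⟩

theorem isShortExact_subquotientMap {B N P : DGSubmodule M} (hBN : B.sub ≤ N.sub)
    (hNP : N.sub ≤ P.sub) :
    IsShortExact (subquotientMap (𝟙 M) (N := B) (N' := B) le_rfl hNP)
      (subquotientMap (𝟙 M) (P := P) (P' := P) hBN le_rfl) where
  injective := subquotientMap_injective fun _ _ hx => hx
  surjective := subquotientMap_surjective fun x hx => ⟨x, hx, rfl⟩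
  exact m := by
    obtain ⟨x, rfl⟩ := (B.sub.submoduleOf P.sub).mkQ_surjective m
    refine (lin_subquotientMap_mkQ_eq_zero_iff x).trans
      ⟨fun hx => ⟨(B.sub.submoduleOf N.sub).mkQ ⟨x, hx⟩, rfl⟩, ?_⟩
    rintro ⟨n, hn⟩
    obtain ⟨y, rfl⟩ := (B.sub.submoduleOf N.sub).mkQ_surjective n
    have hyx : (y : M) - x ∈ B.sub :=
      (Submodule.Quotient.eq (B.sub.submoduleOf P.sub) (x := ⟨y, hNP y.2⟩) (y := x)).1 hn
    exact (Submodule.sub_mem_iff_right N.sub y.2).1 (hBN hyx)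

theorem nonempty_iso_subquotient_of_surjective {p : M ⟶ Q} (hp : Function.Surjective (lin p))
    {N P : DGSubmodule M} (hN : N.sub = LinearMap.ker (lin p)) (hP : P.sub = ⊤) :
    Nonempty (subquotient N P ≅ Q) := by
  let q : P.sub →ₗ[Aᵐᵒᵖ] Q := (lin p).comp P.sub.subtype
  have hq : N.sub.submoduleOf P.sub = LinearMap.ker q := by
    rw [hN]
    rfl
  let g : subquotient N P ⟶ Q :=
    { toLin := (N.sub.submoduleOf P.sub).liftQ q hq.le
      map_gr := by
        rintro i _ ⟨x, hx, rfl⟩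
        exact lin_mem p hx
      map_d := fun m => by
        obtain ⟨x, rfl⟩ := (N.sub.submoduleOf P.sub).mkQ_surjective m
        exact lin_d p x }
  have hg : Function.Injective (lin g) :=
    LinearMap.ker_eq_bot.1 (Submodule.ker_liftQ_eq_bot _ q hq.le hq.ge)
  have := isIso_of_bijective g ⟨hg, fun t => by
    obtain ⟨m, rfl⟩ := hp t
    exact ⟨(N.sub.submoduleOf P.sub).mkQ ⟨m, hP ▸ Submodule.mem_top⟩, rfl⟩⟩
  exact ⟨asIso g⟩

end DGSubmodule

end Subquotient

theorem antitone_snoc {α : Type*} [Preorder α] {n : ℕ} {l : Fin n → α} {m : α} (hl : Antitone l)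
    (hm : ∀ i, m ≤ l i) : Antitone (Fin.snoc l m : Fin (n + 1) → α) := by
  intro i j hij
  cases j using Fin.lastCases with
  | last =>
    rw [Fin.snoc_last]
    cases i using Fin.lastCases with
    | last => rw [Fin.snoc_last]
    | cast i => rw [Fin.snoc_castSucc]; exact hm i
  | cast j =>
    cases i using Fin.lastCases with
    | last => exact absurd hij (Fin.castSucc_lt_last j).not_ge
    | cast i =>
      rw [Fin.snoc_castSucc, Fin.snoc_castSucc]
      exact hl (Fin.castSucc_le_castSucc_iff.1 hij)

section Cellular

variable {k : Type u} [CommRing k] {A : Type v} [Ring A] [Algebra k A] {𝒜 : DGAlgebra k A}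
  (h𝒜 : 𝒜.IsPositiveSemisimple) {W : Type*} (L : W → Type v)
  [∀ x, AddCommGroup (L x)] [∀ x, Module 𝒜.degZeroᵐᵒᵖ (L x)]

open DGModule

include h𝒜 in
theorem DGAlgebra.IsPositiveSemisimple.projective (V : Type*) [AddCommGroup V]
    [Module 𝒜.degZeroᵐᵒᵖ V] : Module.Projective 𝒜.degZeroᵐᵒᵖ V := by
  have := h𝒜.semisimple
  exact Module.projective_of_isSemisimpleRing _ _

/-- `T` is isomorphic, as a dg module, to `{n} L̂_x` for some `x`. -/
def IsShiftedHat (n : ℤ) (T : DGModule 𝒜) : Prop :=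
  ∃ x, Nonempty (T ≅ shift n (𝒜.hat (L x) h𝒜.d_degZero))

/-- `M` is obtained from zero by successively attaching cells, i.e. by taking mapping cones of
morphisms from `{l - 1} L̂_x`, where the numbers `l` are decreasing and bounded below by `c`. -/
inductive IsCellular : ℤ → DGModule 𝒜 → Prop
  | of_subsingleton (c : ℤ) (M : DGModule 𝒜) (hM : Subsingleton M) : IsCellular c M
  | of_cone {c l : ℤ} {T N M : DGModule 𝒜} (hcl : c ≤ l) (hT : IsShiftedHat h𝒜 L (l - 1) T)
      (hN : IsCellular l N) (χ : T ⟶ N) (e : M ≅ cone χ) : IsCellular c M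

/-- The objects of `dgHot(𝒜)` that are homotopy equivalent to a cellular dg module with cells
`{l} L̂_x`, `c ≤ l`. -/
def isHomotopyCellular (c : ℤ) : ObjectProperty (DGHot 𝒜) :=
  ObjectProperty.map (IsCellular h𝒜 L c) DGHot.quot

/-- The dg submodules `F 0 ≤ F 1 ≤ ⋯` form a filtration of `M` as in the definition of `dgFilt`,
with subquotients `{l i} L̂_x`. -/
structure IsHatFiltration {M : DGModule 𝒜} {n : ℕ} (F : Fin (n + 1) → DGSubmodule M)
    (l : Fin n → ℤ) : Prop where
  bot : (F 0).sub = ⊥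
  top : (F (Fin.last n)).sub = ⊤
  antitone : Antitone l
  le (i : Fin n) : (F i.castSucc).sub ≤ (F i.succ).sub
  isShiftedHat (i : Fin n) :
    IsShiftedHat h𝒜 L (l i) (DGSubmodule.subquotient (F i.castSucc) (F i.succ))

variable {h𝒜 L}

namespace IsShiftedHat

theorem of_iso {n : ℤ} {T T' : DGModule 𝒜} (hT : IsShiftedHat h𝒜 L n T) (e : T' ≅ T) :
    IsShiftedHat h𝒜 L n T' := by
  obtain ⟨x, ⟨e'⟩⟩ := hT
  exact ⟨x, ⟨e ≪≫ e'⟩⟩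

theorem shift {m n p : ℤ} {T : DGModule 𝒜} (hT : IsShiftedHat h𝒜 L n T) (h : m + n = p) :
    IsShiftedHat h𝒜 L p (DGModule.shift m T) := by
  obtain ⟨x, ⟨e⟩⟩ := hT
  obtain ⟨e'⟩ := nonempty_iso_shift_shift h (𝒜.hat (L x) h𝒜.d_degZero)
  exact ⟨x, ⟨(DGModule.shiftFunctor m).mapIso e ≪≫ e'⟩⟩

theorem eq_zeroHom_or_isIso (hL : ∀ x, IsSimpleModule 𝒜.degZeroᵐᵒᵖ (L x)) {p q : ℤ}
    (hqp : q ≤ p) {S T : DGModule 𝒜} (hS : IsShiftedHat h𝒜 L p S) (hT : IsShiftedHat h𝒜 L q T)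
    (ψ : S ⟶ T) : ψ = zeroHom S T ∨ IsIso ψ := by
  obtain ⟨x, ⟨e⟩⟩ := hS
  obtain ⟨y, ⟨e'⟩⟩ := hT
  have := h𝒜.projective (L x)
  have hψ : ψ = e.hom ≫ (e.inv ≫ ψ ≫ e'.hom) ≫ e'.inv := by
    simp only [Category.assoc, Iso.hom_inv_id, Category.comp_id, Iso.hom_inv_id_assoc]
  rcases DGAlgebra.eq_zeroHom_or_isIso_of_le h𝒜.d_degZero h𝒜.gr_neg hqp
    (e.inv ≫ ψ ≫ e'.hom) with h0 | h1
  · left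
    rw [hψ, h0]
    refine hom_ext (LinearMap.ext fun s => ?_)
    simp only [lin_comp, lin_zeroHom, map_zero]
  · right
    rw [hψ]
    infer_instance

theorem exists_iso_cone {l : ℤ} {N M Q : DGModule 𝒜} {f : N ⟶ M} {p : M ⟶ Q}
    (hQ : IsShiftedHat h𝒜 L l Q) (hfp : IsShortExact f p) :
    ∃ T, IsShiftedHat h𝒜 L (l - 1) T ∧ ∃ χ : T ⟶ N, Nonempty (M ≅ cone χ) := by
  obtain ⟨x, ⟨e⟩⟩ := hQ
  have := h𝒜.projective (L x)
  exact ⟨_, shift ⟨x, ⟨e⟩⟩ (by ring), hfp.exists_iso_cone_of_iso_shift_hat e⟩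

end IsShiftedHat

namespace IsCellular

theorem mono {c c' : ℤ} (hc : c' ≤ c) {M : DGModule 𝒜} (hM : IsCellular h𝒜 L c M) :
    IsCellular h𝒜 L c' M := by
  cases hM with
  | of_subsingleton _ _ hM => exact .of_subsingleton _ _ hM
  | of_cone hcl hT hN χ e => exact .of_cone (hc.trans hcl) hT hN χ e

theorem of_iso {c : ℤ} {M M' : DGModule 𝒜} (hM : IsCellular h𝒜 L c M) (e : M' ≅ M) :
    IsCellular h𝒜 L c M' := by
  cases hM with
  | of_subsingleton _ _ hM =>
    exact .of_subsingleton _ _ (lin_bijective e.hom).1.subsingleton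
  | of_cone hcl hT hN χ e' => exact .of_cone hcl hT hN χ (e ≪≫ e')

theorem shift {c : ℤ} {M : DGModule 𝒜} (hM : IsCellular h𝒜 L c M) (n : ℤ) :
    IsCellular h𝒜 L (n + c) (DGModule.shift n M) := by
  induction hM with
  | of_subsingleton _ _ hM => exact .of_subsingleton _ _ hM
  | of_cone hcl hT _ χ e ih =>
    obtain ⟨ψ, ⟨e'⟩⟩ := exists_iso_shift_cone n χ
    exact .of_cone (by lia) (hT.shift (by ring)) ih ψ
      ((DGModule.shiftFunctor n).mapIso e ≪≫ e')

theorem of_isShortExact {c l : ℤ} {N M Q : DGModule 𝒜} {f : N ⟶ M} {p : M ⟶ Q} (hcl : c ≤ l)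
    (hN : IsCellular h𝒜 L l N) (hfp : IsShortExact f p) (hQ : IsShiftedHat h𝒜 L l Q) :
    IsCellular h𝒜 L c M := by
  obtain ⟨T, hT, χ, ⟨e⟩⟩ := hQ.exists_iso_cone hfp
  exact .of_cone hcl hT hN χ e

theorem hat (x : W) : IsCellular h𝒜 L 0 (𝒜.hat (L x) h𝒜.d_degZero) := by
  obtain ⟨e⟩ := nonempty_iso_shift_zero (𝒜.hat (L x) h𝒜.d_degZero)
  exact of_isShortExact le_rfl (.of_subsingleton _ (zeroModule 𝒜) inferInstance)
    isShortExact_zeroHom_id ⟨x, ⟨e.symm⟩⟩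

theorem prop_of_isStrictTriangulated {c : ℤ} {M : DGModule 𝒜} (hM : IsCellular h𝒜 L c M)
    {P : ObjectProperty (DGHot 𝒜)} (hP : DGHot.IsStrictTriangulated P)
    (hPL : ∀ x, P (DGHot.quot.obj (𝒜.hat (L x) h𝒜.d_degZero))) : P (DGHot.quot.obj M) := by
  have := hP.iso
  have := hP.zero
  induction hM with
  | of_subsingleton _ M _ => exact P.prop_of_isZero (isZero_quot_of_subsingleton M)
  | @of_cone _ l T N M _ hT _ χ e ih =>
    obtain ⟨x, ⟨eT⟩⟩ := hT
    have hPT : P (DGHot.quot.obj T) :=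
      P.prop_of_iso (DGHot.quot.mapIso eT).symm (hP.shift (l - 1) _ (hPL x))
    refine P.prop_of_iso (DGHot.quot.mapIso e).symm ?_
    refine hP.third (DGHot.quot.map χ) (DGHot.quot.map (coneInl χ)) (DGHot.quot.map (coneSnd χ))
      ⟨T, N, χ, Iso.refl _, Iso.refl _, Iso.refl _, ?_, ?_, ?_⟩ hPT ih
    · exact (Category.comp_id _).trans (Category.id_comp _).symm
    · exact (Category.comp_id _).trans (Category.id_comp _).symm
    · rw [Iso.refl_hom, CategoryTheory.Functor.map_id, Iso.refl_hom]
      exact (Category.comp_id _).trans (Category.id_comp _).symm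

end IsCellular

instance (c : ℤ) : (isHomotopyCellular h𝒜 L c).IsClosedUnderIsomorphisms :=
  inferInstanceAs (ObjectProperty.map _ _).IsClosedUnderIsomorphisms

namespace IsCellular

theorem isHomotopyCellular {c : ℤ} {M : DGModule 𝒜} (hM : IsCellular h𝒜 L c M) :
    isHomotopyCellular h𝒜 L c (DGHot.quot.obj M) :=
  ObjectProperty.prop_map_obj _ _ hM

/-- The new cell need not have the smallest shift: it is moved past the cells of smaller shift,
or cancels against one of them. -/
theorem isHomotopyCellular_cone (hL : ∀ x, IsSimpleModule 𝒜.degZeroᵐᵒᵖ (L x)) {c : ℤ}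
    {N : DGModule 𝒜} (hN : IsCellular h𝒜 L c N) {l : ℤ} (hl : c ≤ l) {S : DGModule 𝒜}
    (hS : IsShiftedHat h𝒜 L (l - 1) S) (φ : S ⟶ N) :
    _root_.isHomotopyCellular h𝒜 L c (DGHot.quot.obj (cone φ)) := by
  induction hN with
  | of_subsingleton _ N hN =>
    exact (of_cone hl hS (.of_subsingleton _ _ hN) φ (Iso.refl _)).isHomotopyCellular
  | @of_cone c m T N₀ N hcm hT hN₀ χ e ih =>
    rcases le_or_gt l m with hlm | hml
    · exact (of_cone hl hS (.of_cone hlm hT hN₀ χ e) φ (Iso.refl _)).isHomotopyCellular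
    obtain ⟨eφ⟩ := nonempty_iso_cone (Iso.refl S) e (φ := φ) (φ' := φ ≫ e.hom)
      (Category.id_comp _).symm
    refine ObjectProperty.prop_of_iso _ (DGHot.quot.mapIso eφ).symm ?_
    rcases hS.eq_zeroHom_or_isIso hL (Int.le_sub_one_of_lt hml) (hT.shift (add_sub_cancel 1 m))
      ((φ ≫ e.hom) ≫ coneSnd χ) with hzero | hiso
    · obtain ⟨φ', hφ'⟩ := exists_eq_comp_coneInl (φ ≫ e.hom) hzero
      obtain ⟨eswap⟩ := nonempty_iso_cone_swap χ φ'
      rw [hφ']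
      refine ObjectProperty.prop_of_iso _ (DGHot.quot.mapIso eswap).symm ?_
      obtain ⟨K, hK, ⟨eK⟩⟩ := ih hml.le φ'
      obtain ⟨χ', ⟨eχ⟩⟩ := exists_iso_quot_cone_of_iso (χ ≫ coneInl φ') (Iso.refl _) eK.symm
      exact ⟨_, .of_cone hcm hT hK χ' (Iso.refl _), ⟨eχ.symm⟩⟩
    · obtain ⟨ecancel⟩ := nonempty_iso_quot_cone_of_isIso (χ := χ) (φ ≫ e.hom)
      exact ObjectProperty.prop_of_iso _ ecancel.symm (hN₀.mono hcm).isHomotopyCellular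

theorem exists_isHomotopyCellular_cone (hL : ∀ x, IsSimpleModule 𝒜.degZeroᵐᵒᵖ (L x))
    {c c' : ℤ} {X Y : DGModule 𝒜} (hX : IsCellular h𝒜 L c X) (hY : IsCellular h𝒜 L c' Y)
    (φ : X ⟶ Y) : ∃ b, _root_.isHomotopyCellular h𝒜 L b (DGHot.quot.obj (cone φ)) := by
  induction hX with
  | of_subsingleton _ X _ =>
    obtain ⟨e⟩ := nonempty_iso_cone_of_subsingleton φ
    exact ⟨c', (hY.of_iso e.symm).isHomotopyCellular⟩
  | @of_cone _ l T X₀ X _ hT _ χ e ih =>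
    obtain ⟨eφ⟩ := nonempty_iso_cone e (Iso.refl Y) (φ := φ) (φ' := e.inv ≫ φ)
      ((Category.comp_id _).trans (e.hom_inv_id_assoc φ).symm)
    obtain ⟨eoct⟩ := nonempty_iso_cone_octahedronHom χ (e.inv ≫ φ)
    obtain ⟨b, K, hK, ⟨eK⟩⟩ := ih (coneInl χ ≫ e.inv ≫ φ)
    obtain ⟨ψ, ⟨eψ⟩⟩ := exists_iso_quot_cone_of_iso (octahedronHom χ (e.inv ≫ φ)) (Iso.refl _)
      eK.symm
    have hcone := (hK.mono (min_le_left b (l + 1))).isHomotopyCellular_cone hL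
      (min_le_right b (l + 1)) (hT.shift (by ring)) ψ
    exact ⟨min b (l + 1), ObjectProperty.prop_of_iso _
      (DGHot.quot.mapIso (eφ ≪≫ eoct) ≪≫ eψ).symm hcone⟩

end IsCellular

theorem isStrictTriangulated_isHomotopyCellular (hL : ∀ x, IsSimpleModule 𝒜.degZeroᵐᵒᵖ (L x)) :
    DGHot.IsStrictTriangulated fun X => ∃ c, isHomotopyCellular h𝒜 L c X where
  zero := ⟨DGHot.quot.obj (zeroModule 𝒜), isZero_quot_of_subsingleton _, 0,
    (IsCellular.of_subsingleton 0 (zeroModule 𝒜) inferInstance).isHomotopyCellular⟩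
  iso := ⟨fun e ⟨c, hc⟩ => ⟨c, ObjectProperty.prop_of_iso _ e hc⟩⟩
  shift n _ := by
    rintro ⟨c, M, hM, ⟨e⟩⟩
    exact ⟨n + c, _, hM.shift n, ⟨(DGHot.shiftFunctor n).mapIso e⟩⟩
  third _ _ _ := by
    rintro ⟨X', Y', φ, a, b, c, -⟩ ⟨_, MX, hMX, ⟨eX⟩⟩ ⟨_, MY, hMY, ⟨eY⟩⟩
    obtain ⟨φ', ⟨e⟩⟩ := exists_iso_quot_cone_of_iso φ (a.symm ≪≫ eX.symm) (b.symm ≪≫ eY.symm)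
    obtain ⟨d, hd⟩ := hMX.exists_isHomotopyCellular_cone hL hMY φ'
    exact ⟨d, ObjectProperty.prop_of_iso _ (c ≪≫ e).symm hd⟩

theorem hasHatFiltration_iff {M : DGModule 𝒜} :
    HasHatFiltration h𝒜 L M ↔
      ∃ (n : ℕ) (F : Fin (n + 1) → DGSubmodule M) (l : Fin n → ℤ), IsHatFiltration h𝒜 L F l := by
  constructor
  · rintro ⟨n, F, l, x, hbot, htop, hl, hF⟩
    exact ⟨n, F, l, hbot, htop, hl, fun i => (hF i).1, fun i => ⟨x i, (hF i).2⟩⟩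
  · rintro ⟨n, F, l, hF⟩
    choose x hx using hF.isShiftedHat
    exact ⟨n, F, l, x, hF.bot, hF.top, hF.antitone, fun i => ⟨hF.le i, hx i⟩⟩

namespace IsHatFiltration

section

variable {M : DGModule 𝒜} {n : ℕ} {F : Fin (n + 1) → DGSubmodule M} {l : Fin n → ℤ}

theorem isCellular_subquotient (hF : IsHatFiltration h𝒜 L F l) (j : Fin (n + 1)) {c : ℤ}
    (hc : ∀ i : Fin n, i.castSucc < j → c ≤ l i) :
    IsCellular h𝒜 L c (DGSubmodule.subquotient (F 0) (F j)) := by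
  have hmono : Monotone fun j => (F j).sub := Fin.monotone_iff_le_succ.2 hF.le
  induction j using Fin.induction generalizing c with
  | zero =>
    exact .of_subsingleton _ _
      (Submodule.Quotient.subsingleton_iff.2 (Submodule.submoduleOf_self _))
  | succ i ih =>
    exact .of_isShortExact (hc i Fin.castSucc_lt_succ)
      (ih fun j hj => hF.antitone (Fin.castSucc_lt_castSucc_iff.1 hj).le)
      (DGSubmodule.isShortExact_subquotientMap (hmono (Fin.zero_le _)) (hF.le i))
      (hF.isShiftedHat i)

theorem exists_isCellular (hF : IsHatFiltration h𝒜 L F l) : ∃ c, IsCellular h𝒜 L c M := by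
  obtain ⟨c, hc⟩ := (Set.finite_range l).bddBelow
  have hker : (F 0).sub = LinearMap.ker (lin (𝟙 M)) :=
    hF.bot.trans (LinearMap.ker_eq_bot.2 (lin_bijective (𝟙 M)).1).symm
  obtain ⟨e⟩ := DGSubmodule.nonempty_iso_subquotient_of_surjective (lin_bijective (𝟙 M)).2 hker
    hF.top
  exact ⟨c, (hF.isCellular_subquotient (Fin.last n) fun i _ => hc ⟨i, rfl⟩).of_iso e.symm⟩

end

theorem snoc {N M Q : DGModule 𝒜} {f : N ⟶ M} {p : M ⟶ Q} (hfp : IsShortExact f p) {n : ℕ}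
    {F : Fin (n + 1) → DGSubmodule N} {l : Fin n → ℤ} (hF : IsHatFiltration h𝒜 L F l) {m : ℤ}
    (hm : ∀ i, m ≤ l i) (hQ : IsShiftedHat h𝒜 L m Q) :
    IsHatFiltration h𝒜 L
      (Fin.snoc (fun j => (F j).map f) (DGSubmodule.top M) : Fin (n + 2) → DGSubmodule M)
      (Fin.snoc l m : Fin (n + 1) → ℤ) where
  bot := by
    have h0 : (Fin.snoc (fun j => (F j).map f) (DGSubmodule.top M) :
        Fin (n + 2) → DGSubmodule M) 0 = (F 0).map f :=
      Fin.snoc_castSucc (α := fun _ => DGSubmodule M) _ _ 0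
    rw [h0]
    exact (congrArg (Submodule.map (lin f)) hF.bot).trans (Submodule.map_bot _)
  top := by
    rw [Fin.snoc_last]
    rfl
  antitone := antitone_snoc hF.antitone hm
  le i := by
    cases i using Fin.lastCases with
    | last =>
      rw [Fin.succ_last, Fin.snoc_last]
      exact le_top
    | cast i =>
      rw [Fin.succ_castSucc, Fin.snoc_castSucc, Fin.snoc_castSucc]
      exact Submodule.map_mono (hF.le i)
  isShiftedHat i := by
    cases i using Fin.lastCases with
    | last =>
      have hker : ((F (Fin.last n)).map f).sub = LinearMap.ker (lin p) :=
        (congrArg (Submodule.map (lin f)) hF.top).trans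
          ((Submodule.map_top _).trans (LinearMap.exact_iff.1 hfp.exact).symm)
      obtain ⟨e⟩ := DGSubmodule.nonempty_iso_subquotient_of_surjective hfp.surjective hker
        (P := DGSubmodule.top M) rfl
      rw [Fin.succ_last, Fin.snoc_castSucc, Fin.snoc_last, Fin.snoc_last]
      exact hQ.of_iso e
    | cast i =>
      obtain ⟨e⟩ := DGSubmodule.nonempty_iso_subquotient_map hfp.injective (F i.castSucc)
        (F i.succ)
      rw [Fin.succ_castSucc, Fin.snoc_castSucc, Fin.snoc_castSucc, Fin.snoc_castSucc]
      exact (hF.isShiftedHat i).of_iso e.symm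

end IsHatFiltration

namespace IsCellular

theorem exists_isHatFiltration {c : ℤ} {M : DGModule 𝒜} (hM : IsCellular h𝒜 L c M) :
    ∃ (n : ℕ) (F : Fin (n + 1) → DGSubmodule M) (l : Fin n → ℤ),
      IsHatFiltration h𝒜 L F l ∧ ∀ i, c ≤ l i := by
  induction hM with
  | of_subsingleton c M hM =>
    exact ⟨0, fun _ => DGSubmodule.top M, Fin.elim0,
      ⟨Subsingleton.elim _ _, rfl, fun i => i.elim0, fun i => i.elim0, fun i => i.elim0⟩,
      fun i => i.elim0⟩
  | @of_cone c m T N M hcm hT _ χ e ih =>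
    obtain ⟨n, F, l, hF, hml⟩ := ih
    refine ⟨_, _, _, hF.snoc ((isShortExact_cone χ).of_iso e) hml
      (hT.shift (add_sub_cancel 1 m)), Fin.lastCases ?_ fun i => ?_⟩
    · rwa [Fin.snoc_last]
    · rw [Fin.snoc_castSucc]
      exact hcm.trans (hml i)

theorem hasHatFiltration {c : ℤ} {M : DGModule 𝒜} (hM : IsCellular h𝒜 L c M) :
    HasHatFiltration h𝒜 L M := by
  obtain ⟨n, F, l, hF, -⟩ := hM.exists_isHatFiltration
  exact hasHatFiltration_iff.2 ⟨n, F, l, hF⟩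

end IsCellular

theorem dgFilt_le_dgPrae : dgFilt h𝒜 L ≤ dgPrae h𝒜 L := by
  intro X hX P hP hPL
  obtain ⟨_, _, _, hF⟩ := hasHatFiltration_iff.1 hX
  obtain ⟨c, hc⟩ := hF.exists_isCellular
  exact hc.prop_of_isStrictTriangulated hP hPL

theorem dgPrae_le_isoClosure_dgFilt (hL : ∀ x, IsSimpleModule 𝒜.degZeroᵐᵒᵖ (L x)) :
    dgPrae h𝒜 L ≤ (dgFilt h𝒜 L).isoClosure := by
  intro X hX
  obtain ⟨c, M, hM, ⟨e⟩⟩ := hX _ (isStrictTriangulated_isHomotopyCellular hL) fun x =>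
    ⟨0, (IsCellular.hat x).isHomotopyCellular⟩
  exact ⟨DGHot.quot.obj M, hM.hasHatFiltration, ⟨e.symm⟩⟩

end Cellular

theorem theorem4p3_general {k : Type u} [CommRing k] {A : Type v} [Ring A] [Algebra k A]
    (𝒜 : DGAlgebra k A) (h𝒜 : 𝒜.IsPositiveSemisimple)
    {W : Type*} (L : W → Type v) [∀ x, AddCommGroup (L x)] [∀ x, Module 𝒜.degZeroᵐᵒᵖ (L x)]
    (hL : ∀ x, IsSimpleModule 𝒜.degZeroᵐᵒᵖ (L x)) :
    (∀ X : DGHot 𝒜, dgPrae h𝒜 L X → ∃ Y : DGHot 𝒜, dgFilt h𝒜 L Y ∧ Nonempty (X ≅ Y)) ∧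
    ∃ h : dgFilt h𝒜 L ≤ dgPrae h𝒜 L, (ObjectProperty.ιOfLE h).IsEquivalence :=
  ⟨fun X hX => let ⟨Y, hY, hXY⟩ := dgPrae_le_isoClosure_dgFilt hL X hX; ⟨Y, hY, hXY⟩,
    dgFilt_le_dgPrae,
    (ObjectProperty.isEquivalence_ιOfLE_iff _).2 (dgPrae_le_isoClosure_dgFilt hL)⟩

theorem theorem4p3 {k : Type u} [CommRing k] {A : Type v} [Ring A] [Algebra k A]
    (𝒜 : DGAlgebra k A) (h𝒜 : 𝒜.IsPositiveSemisimple)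
    {W : Type*} (L : W → Type v) [∀ x, AddCommGroup (L x)] [∀ x, Module 𝒜.degZeroᵐᵒᵖ (L x)]
    (hL : IsSimpleSystem 𝒜.degZero L) :
    (∀ X : DGHot 𝒜, dgPrae h𝒜 L X → ∃ Y : DGHot 𝒜, dgFilt h𝒜 L Y ∧ Nonempty (X ≅ Y)) ∧
    ∃ h : dgFilt h𝒜 L ≤ dgPrae h𝒜 L, (ObjectProperty.ιOfLE h).IsEquivalence :=
  theorem4p3_general 𝒜 h𝒜 L hL.simple
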